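/- **Theorem 3.2.** Let $k\ge 2$ be an integer and let $\alpha>0$, $r>0$ and $0<p<1$ be real constants. A random instance of Model RB with $n$ variables is generated as follows. Each variable has a domain of size $d=n^{\alpha}$. Independently, and with repetition allowed, $t=r\,n\ln d$ random constraints are drawn. For each of them a set of $k$ distinct variables is chosen uniformly among the $\binom{n}{k}$ such sets, and then a set of $q=p\,d^{k}$ incompatible tuples of values for these variables is chosen uniformly among the $\binom{d^k}{q}$ such sets. (For each $n$, the numbers $n^\alpha$, $r\,n\ln d$ and $p\,d^k$ are rounded to integers, each of them either down or up, in an arbitrary way; $d$ in the last two is the rounded domain size.) Let $X$ be the number of solutions, i.e. of assignments of values to all $n$ variables under which no constraint has its variables assigned one of its incompatible tuples. Set $\tau=e^{1/r}$ and $p_{cr}=1-\frac1\tau$. If $(2k-1)\alpha>1$ and $k\ge\frac{\tau\ln\tau}{\tau-1}$, then $$\lim_{n\to\infty}\Pr[X>0]=1\ \text{ if } p<p_{cr},\qquad \lim_{n\to\infty}\Pr[X>0]=0\ \text{ if } p>p_{cr}.$$ -/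

import Mathlib

open Filter Topology

namespace ModelRB

/-- A constraint of Model RB on the variables `Fin n` with common domain `Fin d`: its scope, a set
of `k` distinct variables, and its set of exactly `q` incompatible tuples of values. The entries of
a tuple belong to the variables of the scope listed in increasing order. -/
abbrev Constraint (n d k q : ℕ) : Type :=
  {s : Finset (Fin n) // s.card = k} × {R : Finset (Fin k → Fin d) // R.card = q}

/-- An instance of Model RB: a sequence of `t` constraints, repetitions allowed. -/
abbrev RBInstance (n d k q t : ℕ) : Type :=
  Fin t → Constraint n d k q

/-- The assignment `σ` satisfies the constraint `C` if the tuple of values that `σ` gives to the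
variables in the scope of `C` is not one of the incompatible tuples. -/
def Satisfies {n d k q : ℕ} (σ : Fin n → Fin d) (C : Constraint n d k q) : Prop :=
  (fun j : Fin k => σ (C.1.1.orderEmbOfFin C.1.2 j)) ∉ C.2.1

/-- The solutions of an instance: the assignments that satisfy all its constraints. -/
def solutions {n d k q t : ℕ} (I : RBInstance n d k q t) : Set (Fin n → Fin d) :=
  {σ | ∀ i, Satisfies σ (I i)}

/-- The number `X` of solutions of an instance. -/
noncomputable def numSolutions {n d k q t : ℕ} (I : RBInstance n d k q t) : ℕ :=
  (solutions I).ncard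

/-- The probability of an event for a random instance. The `t` constraints are independent, the
scope of each is uniform among the `n.choose k` sets of `k` variables, and its set of incompatible
tuples is uniform among the `(d ^ k).choose q` sets of `q` tuples; so the random instance is
uniformly distributed on the finite type of all instances. -/
noncomputable def prob {n d k q t : ℕ} (E : Set (RBInstance n d k q t)) : ℝ :=
  (E.ncard : ℝ) / (Nat.card (RBInstance n d k q t) : ℝ)

/-- `Pr[X > 0]`, the probability that a random instance is satisfiable. -/
noncomputable def satProb (n d k q t : ℕ) : ℝ :=
  prob {I : RBInstance n d k q t | 0 < numSolutions I}

/-- The natural number `m` is the (nonnegative) real number `x` rounded down or up. -/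
def IsRounding (m : ℕ) (x : ℝ) : Prop :=
  m = ⌊x⌋₊ ∨ m = ⌈x⌉₊

end ModelRB

/-!
The proof is by the first and second moment methods for the number `X` of solutions.

Write `N = d ^ k`. A fixed assignment satisfies a random constraint with probability `1 - q / N`, so
the mean of `X` is `d ^ n * (1 - q / N) ^ t = exp (n log d * (1 + r log (1 - p) + o(1)))`. Above the
threshold `r * -log (1 - p) > 1` and Markov's inequality gives the limit `0`
(`tendsto_satProb_zero`).

Below the threshold, `Pr[X > 0] ≥ (E X) ^ 2 / E (X ^ 2)`. Whether two assignments satisfy a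
constraint jointly depends only on whether its scope lies in the set on which they agree, so the
ratio `E (X ^ 2) / (E X) ^ 2` is the mean of
`(1 + c * (S.choose k / n.choose k - 1 / N)) ^ t`, where `c` tends to `p / (1 - p)` and the number
`S` of agreements is binomial with parameters `n` and `1 / d` (`one_le_satProb_mul`). The bracketed
deviation has mean exactly zero, hence with `Z` the deviation multiplied by `T = t * c` the mean of
`exp Z` over the event `Z ≤ 1` is at most one plus the variance of `Z`
(`sum_weight_agreeSet_le`). That variance is of order `n (log n) ^ 2 / d ^ (2 * k - 1)`, up to terms
that vanish anyway, and tends to zero because `(2 k - 1) α > 1` (`tendsto_variance`). Without the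
centring one would need `k α > 1`.

The event `Z > 1` forces `S` to be atypically large, and there the Chernoff bound for `S` beats the
weight (`exp_rate_mul_weight_le`). For `S` within a constant factor of `n / d` this again uses
`(2 k - 1) α > 1`. For `S` of order `n` it is the inequality
`1 + (exp y - 1) * s ^ k ≤ exp (y * s)` for `s = S / n` and `y` slightly above `-log (1 - p)`
(`one_add_mul_pow_le_exp`), which follows from the hypothesis on `k` and bounds the weight by
`d ^ (θ * S)` with `θ = r * y < 1`, against a probability of about `d ^ (-S)`.
-/

namespace ModelRB

variable {n d k q t : ℕ}

/-! ### Moments of the number of solutions -/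

/-- The tuple of values that the assignment `σ` gives to the variables of the scope `s`. -/
def tupleOn (σ : Fin n → Fin d) (s : {s : Finset (Fin n) // s.card = k}) : Fin k → Fin d :=
  fun j => σ (s.1.orderEmbOfFin s.2 j)

/-- The set of variables on which two assignments agree. -/
def agreeSet (σ σ' : Fin n → Fin d) : Finset (Fin n) :=
  Finset.univ.filter fun i => σ i = σ' i

theorem tupleOn_eq_iff (σ σ' : Fin n → Fin d) (s : {s : Finset (Fin n) // s.card = k}) :
    tupleOn σ s = tupleOn σ' s ↔ s.1 ⊆ agreeSet σ σ' := by
  constructor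
  · intro h i hi
    have hi' : i ∈ Set.range (s.1.orderEmbOfFin s.2) := by
      rw [Finset.range_orderEmbOfFin]; exact hi
    obtain ⟨j, rfl⟩ := hi'
    simpa [agreeSet, tupleOn] using congrFun h j
  · intro h
    funext j
    have := h (Finset.orderEmbOfFin_mem s.1 s.2 j)
    simpa [agreeSet, tupleOn] using this

theorem card_disjoint_subsets {β : Type*} [Fintype β] [DecidableEq β] (V : Finset β) (q : ℕ) :
    (Finset.univ.filter fun R : {R : Finset β // R.card = q} => Disjoint R.1 V).card
      = (Fintype.card β - V.card).choose q := by
  rw [← Finset.card_univ, ← Finset.card_sdiff_of_subset (Finset.subset_univ V),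
    ← Finset.card_powersetCard, ← Finset.card_map (Function.Embedding.subtype _)]
  congr 1
  ext R
  simp only [Finset.mem_map, Finset.mem_filter, Finset.mem_univ, true_and,
    Function.Embedding.subtype_apply, Subtype.exists, exists_and_left, exists_prop,
    exists_eq_right_right, Finset.mem_powersetCard, Finset.subset_sdiff, Finset.subset_univ]

open Classical in
/-- The number of constraints satisfied by both of two assignments depends only on the number of
variables on which they agree: their tuples on a scope coincide exactly when the scope consists
of such variables. -/
theorem card_constraints_satisfied_both (σ σ' : Fin n → Fin d) :
    (Finset.univ.filter fun C : Constraint n d k q => Satisfies σ C ∧ Satisfies σ' C).card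
      = (agreeSet σ σ').card.choose k * (d ^ k - 1).choose q
        + (n.choose k - (agreeSet σ σ').card.choose k) * (d ^ k - 2).choose q := by
  have h1 : ∀ s : {s : Finset (Fin n) // s.card = k},
      (Finset.univ.filter fun R : {R : Finset (Fin k → Fin d) // R.card = q} =>
        tupleOn σ s ∉ R.1 ∧ tupleOn σ' s ∉ R.1).card
      = if s.1 ⊆ agreeSet σ σ' then (d ^ k - 1).choose q else (d ^ k - 2).choose q := by
    intro s
    have := card_disjoint_subsets ({tupleOn σ s, tupleOn σ' s} : Finset (Fin k → Fin d)) q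
    have h2 : (Finset.univ.filter fun R : {R : Finset (Fin k → Fin d) // R.card = q} =>
        tupleOn σ s ∉ R.1 ∧ tupleOn σ' s ∉ R.1)
        = (Finset.univ.filter fun R : {R : Finset (Fin k → Fin d) // R.card = q} =>
          Disjoint R.1 {tupleOn σ s, tupleOn σ' s}) := by
      ext R
      simp [Finset.disjoint_insert_right]
    rw [h2, this]
    simp only [Fintype.card_pi, Fintype.card_fin, Finset.prod_const, Finset.card_univ]
    split_ifs with h
    · rw [(tupleOn_eq_iff σ σ' s).2 h]; simp
    · rw [Finset.card_pair (fun h' => h ((tupleOn_eq_iff σ σ' s).1 h'))]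
  have h3 : (Finset.univ.filter fun C : Constraint n d k q => Satisfies σ C ∧ Satisfies σ' C).card
      = ∑ s : {s : Finset (Fin n) // s.card = k},
        (Finset.univ.filter fun R : {R : Finset (Fin k → Fin d) // R.card = q} =>
        tupleOn σ s ∉ R.1 ∧ tupleOn σ' s ∉ R.1).card := by
    simp only [Finset.card_filter]
    rw [Fintype.sum_prod_type]
    refine Finset.sum_congr rfl fun s _ => Finset.sum_congr rfl fun R _ => ?_
    congr 1
  have h4 : (Finset.univ.filter fun s : {s : Finset (Fin n) // s.card = k} =>
      s.1 ⊆ agreeSet σ σ').card = (agreeSet σ σ').card.choose k := by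
    rw [← Finset.card_powersetCard, ← Finset.card_map (Function.Embedding.subtype _)]
    congr 1
    ext R
    simp only [Finset.mem_map, Finset.mem_filter, Finset.mem_univ, true_and,
      Function.Embedding.subtype_apply, Subtype.exists, exists_and_left, exists_prop,
      exists_eq_right_right, Finset.mem_powersetCard]
  have h5 : (Finset.univ.filter fun s : {s : Finset (Fin n) // s.card = k} =>
      ¬ s.1 ⊆ agreeSet σ σ').card = n.choose k - (agreeSet σ σ').card.choose k := by
    have := Finset.card_filter_add_card_filter_not (s := Finset.univ)
      (fun s : {s : Finset (Fin n) // s.card = k} => s.1 ⊆ agreeSet σ σ')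
    rw [h4, Finset.card_univ, Fintype.card_finset_len, Fintype.card_fin] at this
    omega
  rw [h3, Finset.sum_congr rfl fun s _ => h1 s, Finset.sum_ite, Finset.sum_const, Finset.sum_const,
    h4, h5]
  simp

open Classical in
theorem card_constraints_satisfied (σ : Fin n → Fin d) :
    (Finset.univ.filter fun C : Constraint n d k q => Satisfies σ C).card
      = n.choose k * (d ^ k - 1).choose q := by
  have h := card_constraints_satisfied_both (k := k) (q := q) σ σ
  simpa [agreeSet] using h

theorem card_constraint : Fintype.card (Constraint n d k q) = n.choose k * (d ^ k).choose q := by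
  simp [Fintype.card_prod, Fintype.card_finset_len]

open Classical in
theorem card_instances_forall (P : Constraint n d k q → Prop) :
    (Finset.univ.filter fun I : RBInstance n d k q t => ∀ i, P (I i)).card
      = (Finset.univ.filter P).card ^ t := by
  have : (Finset.univ.filter fun I : RBInstance n d k q t => ∀ i, P (I i))
      = Fintype.piFinset fun _ : Fin t => Finset.univ.filter P := by
    ext I; simp
  rw [this, Fintype.card_piFinset]
  simp

open Classical in
theorem numSolutions_eq_sum (I : RBInstance n d k q t) :
    (numSolutions I : ℝ) = ∑ σ : Fin n → Fin d, if σ ∈ solutions I then (1 : ℝ) else 0 := by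
  rw [numSolutions, Set.ncard_eq_toFinset_card', Finset.sum_boole]
  congr 2
  ext σ; simp

/-- The first moment of the number of solutions, as an unnormalised count. -/
theorem sum_numSolutions :
    ∑ I : RBInstance n d k q t, (numSolutions I : ℝ)
      = (d : ℝ) ^ n * ((n.choose k : ℝ) * ((d ^ k - 1).choose q : ℝ)) ^ t := by
  classical
  simp only [numSolutions_eq_sum]
  rw [Finset.sum_comm]
  have : ∀ σ : Fin n → Fin d, (∑ I : RBInstance n d k q t,
      if σ ∈ solutions I then (1 : ℝ) else 0)
      = ((n.choose k : ℝ) * ((d ^ k - 1).choose q : ℝ)) ^ t := by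
    intro σ
    rw [Finset.sum_boole]
    have h := card_instances_forall (t := t) (fun C : Constraint n d k q => Satisfies σ C)
    rw [card_constraints_satisfied] at h
    rw [← Nat.cast_mul, ← Nat.cast_pow, ← h]
    congr 2
    ext I
    simp only [Finset.mem_filter, Finset.mem_univ, true_and]
    rfl
  rw [Finset.sum_congr rfl fun σ _ => this σ]
  simp

/-- The second moment of the number of solutions, as an unnormalised count. -/
theorem sum_numSolutions_sq :
    ∑ I : RBInstance n d k q t, (numSolutions I : ℝ) ^ 2
      = ∑ σ : Fin n → Fin d, ∑ σ' : Fin n → Fin d,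
        (((agreeSet σ σ').card.choose k : ℝ) * ((d ^ k - 1).choose q : ℝ)
        + ((n.choose k : ℝ) - ((agreeSet σ σ').card.choose k : ℝ)) * ((d ^ k - 2).choose q : ℝ))
          ^ t := by
  classical
  simp only [numSolutions_eq_sum, sq, Finset.sum_mul_sum]
  rw [Finset.sum_comm]
  refine Finset.sum_congr rfl fun σ _ => ?_
  rw [Finset.sum_comm]
  refine Finset.sum_congr rfl fun σ' _ => ?_
  have h : (Finset.univ.filter fun I : RBInstance n d k q t =>
      ∀ i, Satisfies σ (I i) ∧ Satisfies σ' (I i)).card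
      = ((agreeSet σ σ').card.choose k * (d ^ k - 1).choose q
        + (n.choose k - (agreeSet σ σ').card.choose k) * (d ^ k - 2).choose q) ^ t := by
    rw [← card_constraints_satisfied_both σ σ']
    convert! card_instances_forall (t := t)
      (fun C : Constraint n d k q => Satisfies σ C ∧ Satisfies σ' C)
  have hle : (agreeSet σ σ').card.choose k ≤ n.choose k :=
    Nat.choose_le_choose k ((Finset.card_le_univ _).trans (by simp))
  have h' := congrArg (fun m : ℕ => (m : ℝ)) h
  simp only [Nat.cast_pow, Nat.cast_add, Nat.cast_mul, Nat.cast_sub hle] at h'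
  rw [← h', ← Finset.sum_boole]
  refine Finset.sum_congr rfl fun I _ => ?_
  have hand : (∀ i, Satisfies σ (I i) ∧ Satisfies σ' (I i))
      ↔ σ ∈ solutions I ∧ σ' ∈ solutions I := forall_and
  simp only [hand]
  by_cases h1 : σ ∈ solutions I <;> by_cases h2 : σ' ∈ solutions I <;> simp [h1, h2]

open Classical in
theorem satProb_eq :
    satProb n d k q t
      = ((Finset.univ.filter fun I : RBInstance n d k q t => 0 < numSolutions I).card : ℝ)
        / ((n.choose k : ℝ) * ((d ^ k).choose q : ℝ)) ^ t := by
  rw [satProb, prob, Set.ncard_eq_toFinset_card', Nat.card_eq_fintype_card, Fintype.card_fun,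
    card_constraint]
  congr 2
  · congr 1; ext I; simp
  · simp

/-- Markov's inequality: satisfiability is at most as likely as the expected number of
solutions. -/
theorem satProb_le_first_moment :
    satProb n d k q t
      ≤ (d : ℝ) ^ n * ((n.choose k : ℝ) * ((d ^ k - 1).choose q : ℝ)) ^ t
        / ((n.choose k : ℝ) * ((d ^ k).choose q : ℝ)) ^ t := by
  classical
  rw [satProb_eq, ← sum_numSolutions]
  refine div_le_div_of_nonneg_right ?_ (by positivity)
  rw [← Finset.sum_boole]
  refine Finset.sum_le_sum fun I _ => ?_
  split_ifs with h
  · exact_mod_cast h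
  · positivity

theorem satProb_le_one : satProb n d k q t ≤ 1 := by
  classical
  rw [satProb_eq]
  refine div_le_one_of_le₀ ?_ (by positivity)
  have h := Finset.card_le_univ
    (Finset.univ.filter fun I : RBInstance n d k q t => 0 < numSolutions I)
  rw [Fintype.card_fun, card_constraint, Fintype.card_fin] at h
  exact_mod_cast h

theorem satProb_nonneg : 0 ≤ satProb n d k q t := by
  rw [satProb, prob]; positivity

/-- The Cauchy–Schwarz form of the second moment method. -/
theorem first_moment_sq_le :
    (∑ I : RBInstance n d k q t, (numSolutions I : ℝ)) ^ 2
      ≤ satProb n d k q t * ((n.choose k : ℝ) * ((d ^ k).choose q : ℝ)) ^ t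
        * ∑ I : RBInstance n d k q t, (numSolutions I : ℝ) ^ 2 := by
  classical
  by_cases h0 : ((n.choose k : ℝ) * ((d ^ k).choose q : ℝ)) ^ t = 0
  · have : Fintype.card (RBInstance n d k q t) = 0 := by
      rw [Fintype.card_fun, card_constraint, Fintype.card_fin]
      exact_mod_cast h0
    have := Fintype.card_eq_zero_iff.1 this
    simp
  rw [satProb_eq, div_mul_cancel₀ _ h0]
  have h := Finset.sum_mul_sq_le_sq_mul_sq Finset.univ
    (fun I : RBInstance n d k q t => if 0 < numSolutions I then (1 : ℝ) else 0)
    (fun I => (numSolutions I : ℝ))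
  have h1 : ∀ I : RBInstance n d k q t,
      (if 0 < numSolutions I then (1 : ℝ) else 0) * (numSolutions I : ℝ) = numSolutions I := by
    intro I
    split_ifs with h
    · simp
    · have : numSolutions I = 0 := by omega
      simp [this]
  simp only [h1, ite_pow, one_pow, ne_eq, OfNat.ofNat_ne_zero, not_false_eq_true, zero_pow,
    Finset.sum_boole] at h
  exact h

/-! ### Moments of the agreement set of two assignments -/

theorem card_agreeSet_superset (σ : Fin n → Fin d) (A : Finset (Fin n)) :
    (Finset.univ.filter fun σ' : Fin n → Fin d => A ⊆ agreeSet σ σ').card = d ^ (n - A.card) := by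
  have h : (Finset.univ.filter fun σ' : Fin n → Fin d => A ⊆ agreeSet σ σ')
      = Fintype.piFinset fun i => if i ∈ A then {σ i} else Finset.univ := by
    ext σ'
    simp only [Finset.mem_filter, Finset.mem_univ, true_and, Fintype.mem_piFinset]
    refine ⟨fun h i => ?_, fun h i hi => ?_⟩
    · split_ifs with hi
      · have := h hi
        simp only [agreeSet, Finset.mem_filter, Finset.mem_univ, true_and] at this
        simp [this]
      · simp
    · have := h i
      rw [if_pos hi, Finset.mem_singleton] at this
      simp [agreeSet, this]
  rw [h, Fintype.card_piFinset]
  have h2 : ∀ i, (if i ∈ A then ({σ i} : Finset (Fin d)) else Finset.univ).card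
      = if i ∈ A then 1 else d := by
    intro i; split_ifs <;> simp
  simp only [h2]
  rw [Finset.prod_ite, Finset.prod_const_one, one_mul, Finset.prod_const]
  congr 1
  rw [Finset.filter_not, Finset.card_sdiff_of_subset (Finset.filter_subset _ _)]
  simp

theorem choose_agreeSet_eq_sum (σ σ' : Fin n → Fin d) :
    ((agreeSet σ σ').card.choose k : ℝ)
      = ∑ A ∈ (Finset.univ : Finset (Fin n)).powersetCard k,
          if A ⊆ agreeSet σ σ' then (1 : ℝ) else 0 := by
  rw [Finset.sum_boole, ← Finset.card_powersetCard]
  congr 2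
  ext A
  simp [Finset.mem_powersetCard, and_comm]

/-- The mean of `(S choose k)` over `σ'`, where `S` is the number of variables on which `σ'`
agrees with `σ`. -/
theorem sum_choose_agreeSet (σ : Fin n → Fin d) (hkn : k ≤ n) :
    (∑ σ' : Fin n → Fin d, ((agreeSet σ σ').card.choose k : ℝ)) * (d : ℝ) ^ k
      = (n.choose k : ℝ) * (d : ℝ) ^ n := by
  simp only [choose_agreeSet_eq_sum]
  rw [Finset.sum_comm]
  have h : ∀ A ∈ (Finset.univ : Finset (Fin n)).powersetCard k,
      (∑ σ' : Fin n → Fin d, if A ⊆ agreeSet σ σ' then (1 : ℝ) else 0) = (d : ℝ) ^ (n - k) := by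
    intro A hA
    rw [Finset.sum_boole, card_agreeSet_superset, (Finset.mem_powersetCard.1 hA).2]
    simp
  rw [Finset.sum_congr rfl h, Finset.sum_const, Finset.card_powersetCard, Finset.card_univ,
    Fintype.card_fin, nsmul_eq_mul, mul_assoc, ← pow_add, Nat.sub_add_cancel hkn]

theorem sum_choose_agreeSet_sq (σ : Fin n → Fin d) :
    (∑ σ' : Fin n → Fin d, ((agreeSet σ σ').card.choose k : ℝ) ^ 2) * (d : ℝ) ^ (2 * k)
      = (d : ℝ) ^ n * ∑ A ∈ (Finset.univ : Finset (Fin n)).powersetCard k,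
          ∑ B ∈ (Finset.univ : Finset (Fin n)).powersetCard k, (d : ℝ) ^ (A ∩ B).card := by
  simp only [choose_agreeSet_eq_sum, sq, Finset.sum_mul_sum]
  rw [Finset.sum_comm, Finset.sum_mul, Finset.mul_sum]
  refine Finset.sum_congr rfl fun A hA => ?_
  rw [Finset.sum_comm, Finset.sum_mul, Finset.mul_sum]
  refine Finset.sum_congr rfl fun B hB => ?_
  have h : ∀ σ' : Fin n → Fin d, ((if A ⊆ agreeSet σ σ' then (1 : ℝ) else 0)
      * if B ⊆ agreeSet σ σ' then (1 : ℝ) else 0)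
      = if A ∪ B ⊆ agreeSet σ σ' then (1 : ℝ) else 0 := by
    intro σ'
    by_cases h1 : A ⊆ agreeSet σ σ' <;> by_cases h2 : B ⊆ agreeSet σ σ' <;>
      simp [h1, h2, Finset.union_subset_iff]
  simp only [h]
  rw [Finset.sum_boole, card_agreeSet_superset, Nat.cast_pow, ← pow_add, ← pow_add]
  congr 1
  have h1 := Finset.card_union_add_card_inter A B
  rw [(Finset.mem_powersetCard.1 hA).2, (Finset.mem_powersetCard.1 hB).2] at h1
  have h2 : (A ∪ B).card ≤ n := (Finset.card_le_univ _).trans (by simp)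
  omega

theorem choose_sub_mul_pow_le (hkn : k ≤ n) (j : ℕ) (hj : j ≤ k) :
    (n - j).choose (k - j) * n ^ j ≤ n.choose k * k ^ j := by
  induction j with
  | zero => simp
  | succ j ih =>
    have ih := ih (by omega)
    obtain ⟨a, rfl⟩ : ∃ a, k = j + 1 + a := ⟨k - (j + 1), by omega⟩
    obtain ⟨b, rfl⟩ : ∃ b, n = j + 1 + a + b := ⟨n - (j + 1 + a), by omega⟩
    have e1 : j + 1 + a + b - (j + 1) = a + b := by omega
    have e2 : j + 1 + a - (j + 1) = a := by omega
    have e3 : j + 1 + a + b - j = a + b + 1 := by omega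
    have e4 : j + 1 + a - j = a + 1 := by omega
    rw [e3, e4] at ih
    rw [e1, e2]
    have h := Nat.add_one_mul_choose_eq (a + b) a
    refine Nat.le_of_mul_le_mul_left ?_ (Nat.succ_pos (a + b))
    calc (a + b).succ * ((a + b).choose a * (j + 1 + a + b) ^ (j + 1))
        = ((a + b + 1) * (a + b).choose a) * ((j + 1 + a + b) ^ j * (j + 1 + a + b)) := by
          rw [pow_succ, Nat.succ_eq_add_one]; ring
      _ = ((a + b + 1).choose (a + 1) * (j + 1 + a + b) ^ j)
            * ((a + 1) * (j + 1 + a + b)) := by rw [h]; ring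
      _ ≤ ((j + 1 + a + b).choose (j + 1 + a) * (j + 1 + a) ^ j)
            * ((a + b + 1) * (j + 1 + a)) := by
          refine Nat.mul_le_mul ih ?_
          nlinarith
      _ = (a + b).succ * ((j + 1 + a + b).choose (j + 1 + a) * (j + 1 + a) ^ (j + 1)) := by
          rw [pow_succ (j + 1 + a)]; simp only [Nat.succ_eq_add_one]; ring

/-- The size of the intersection of a fixed and a uniformly random `k`-subset is hypergeometric;
its generating function at `d` is at most that of a binomial variable. -/
theorem sum_pow_card_inter_le (hd : 0 < d) (hkn : k ≤ n) (A : Finset (Fin n))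
    (hA : A.card = k) :
    ∑ B ∈ (Finset.univ : Finset (Fin n)).powersetCard k, (d : ℝ) ^ (A ∩ B).card
      ≤ (n.choose k : ℝ) * (1 + (d : ℝ) * k / n) ^ k := by
  have hd1 : (0 : ℝ) ≤ (d : ℝ) - 1 := by
    have : (1 : ℝ) ≤ d := by exact_mod_cast hd
    linarith
  have h1 : ∀ B : Finset (Fin n), (d : ℝ) ^ (A ∩ B).card
      = ∑ U ∈ A.powerset, if U ⊆ B then ((d : ℝ) - 1) ^ U.card else 0 := by
    intro B
    have := Finset.sum_pow_mul_eq_add_pow ((d : ℝ) - 1) 1 (A ∩ B)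
    simp only [one_pow, mul_one, sub_add_cancel] at this
    rw [← this, ← Finset.sum_filter]
    refine Finset.sum_congr ?_ fun _ _ => rfl
    ext U
    simp only [Finset.mem_filter, Finset.mem_powerset, Finset.subset_inter_iff]
  simp only [h1]
  rw [Finset.sum_comm]
  have h2 : ∀ U ∈ A.powerset,
      (∑ B ∈ (Finset.univ : Finset (Fin n)).powersetCard k,
        if U ⊆ B then ((d : ℝ) - 1) ^ U.card else 0)
      ≤ (n.choose k : ℝ) * ((d : ℝ) * k / n) ^ U.card := by
    intro U hU
    have hUk : U.card ≤ k := hA ▸ Finset.card_le_card (Finset.mem_powerset.1 hU)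
    rw [← Finset.sum_filter, Finset.sum_const,
      Finset.card_filter_powersetCard_subset U _ k (Finset.subset_univ U) hUk, Finset.card_univ,
      Fintype.card_fin, nsmul_eq_mul]
    have h3 : (((n - U.card).choose (k - U.card) : ℕ) : ℝ)
        ≤ (n.choose k : ℝ) * ((k : ℝ) / n) ^ U.card := by
      rcases Nat.eq_zero_or_pos U.card with h0 | hpos
      · simp [h0]
      have hn : (0 : ℝ) < n := by
        have : 0 < n := by omega
        exact_mod_cast this
      rw [div_pow, ← mul_div_assoc, le_div_iff₀ (by positivity)]
      exact_mod_cast choose_sub_mul_pow_le hkn U.card hUk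
    calc (((n - U.card).choose (k - U.card) : ℕ) : ℝ) * ((d : ℝ) - 1) ^ U.card
        ≤ ((n.choose k : ℝ) * ((k : ℝ) / n) ^ U.card) * (d : ℝ) ^ U.card := by
          gcongr; linarith
      _ = (n.choose k : ℝ) * ((d : ℝ) * k / n) ^ U.card := by
          rw [mul_assoc, ← mul_pow]; congr 2; ring
  refine (Finset.sum_le_sum h2).trans (le_of_eq ?_)
  rw [← Finset.mul_sum]
  have := Finset.sum_pow_mul_eq_add_pow ((d : ℝ) * k / n) 1 A
  simp only [one_pow, mul_one] at this
  rw [this, hA, add_comm]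

theorem sum_choose_agreeSet_sq_le (σ : Fin n → Fin d) (hd : 0 < d) (hkn : k ≤ n) :
    (∑ σ' : Fin n → Fin d, ((agreeSet σ σ').card.choose k : ℝ) ^ 2) * (d : ℝ) ^ (2 * k)
      ≤ (d : ℝ) ^ n * (n.choose k : ℝ) ^ 2 * (1 + (d : ℝ) * k / n) ^ k := by
  rw [sum_choose_agreeSet_sq, mul_assoc]
  refine mul_le_mul_of_nonneg_left ?_ (by positivity)
  refine (Finset.sum_le_sum fun A hA =>
    sum_pow_card_inter_le hd hkn A (Finset.mem_powersetCard.1 hA).2).trans (le_of_eq ?_)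
  rw [Finset.sum_const, Finset.card_powersetCard, Finset.card_univ, Fintype.card_fin,
    nsmul_eq_mul]
  ring

theorem sum_pow_card_agreeSet (σ : Fin n → Fin d) (x : ℝ) :
    ∑ σ' : Fin n → Fin d, x ^ (agreeSet σ σ').card = (d + (x - 1)) ^ n := by
  have h : ∀ σ' : Fin n → Fin d, x ^ (agreeSet σ σ').card
      = ∏ i, if σ i = σ' i then x else 1 := by
    intro σ'
    rw [Finset.prod_ite, Finset.prod_const_one, mul_one, Finset.prod_const, agreeSet]
  simp only [h]
  rw [← Fintype.prod_sum fun (i : Fin n) (a : Fin d) => if σ i = a then x else 1]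
  have h2 : ∀ i : Fin n, (∑ a : Fin d, if σ i = a then x else 1) = d + (x - 1) := by
    intro i
    have h3 : ∀ a : Fin d, (if σ i = a then x else 1) = 1 + if σ i = a then x - 1 else 0 := by
      intro a; split_ifs <;> ring
    simp [h3, Finset.sum_add_distrib]
  simp [h2]

/-- The Chernoff bound for the number of agreements, which is binomial with parameters `n` and
`1 / d`. -/
theorem card_agreeSet_card_eq_le (σ : Fin n → Fin d) (hd : 0 < d) {j : ℕ} (hj : 0 < j)
    (hjn : j ≤ n) :
    ((Finset.univ.filter fun σ' : Fin n → Fin d => (agreeSet σ σ').card = j).card : ℝ)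
      ≤ (d : ℝ) ^ n * Real.exp (-(j * Real.log (j * d / n)) + j - n / d) := by
  have hd' : (0 : ℝ) < d := by exact_mod_cast hd
  have hj' : (0 : ℝ) < j := by exact_mod_cast hj
  have hn' : (0 : ℝ) < n := by exact_mod_cast hj.trans_le hjn
  have hd1 : (1 : ℝ) ≤ d := by exact_mod_cast hd
  set x : ℝ := j * d / n with hx
  have hx0 : 0 < x := by positivity
  have h1 : ((Finset.univ.filter fun σ' : Fin n → Fin d => (agreeSet σ σ').card = j).card : ℝ)
      * x ^ j ≤ (d + (x - 1)) ^ n := by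
    rw [← sum_pow_card_agreeSet σ x, ← Finset.sum_boole, Finset.sum_mul]
    refine Finset.sum_le_sum fun σ' _ => ?_
    split_ifs with h
    · simp [h]
    · simp only [zero_mul]; positivity
  have h2 : (d + (x - 1)) ^ n ≤ (d : ℝ) ^ n * Real.exp (j - n / d) := by
    have h3 : (d : ℝ) + (x - 1) ≤ d * Real.exp ((x - 1) / d) := by
      have := Real.add_one_le_exp ((x - 1) / d)
      calc (d : ℝ) + (x - 1) = d * ((x - 1) / d + 1) := by field_simp; ring
        _ ≤ _ := by gcongr
    calc ((d : ℝ) + (x - 1)) ^ n ≤ (d * Real.exp ((x - 1) / d)) ^ n := by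
          refine pow_le_pow_left₀ ?_ h3 n
          linarith
      _ = (d : ℝ) ^ n * Real.exp (j - n / d) := by
          rw [mul_pow, ← Real.exp_nat_mul]
          congr 2
          rw [hx]; field_simp
  have h4 : Real.exp (-(j * Real.log x) + j - n / d) = Real.exp (j - n / d) / x ^ j := by
    rw [← Real.exp_log (pow_pos hx0 j), ← Real.exp_sub, Real.log_pow]
    congr 1; ring
  rw [h4, ← mul_div_assoc, le_div_iff₀ (by positivity)]
  exact h1.trans h2

/-! ### The mean of a weight of the agreement set -/

theorem exp_le_one_add_add_sq {x : ℝ} (hx : x ≤ 1) : Real.exp x ≤ 1 + x + x ^ 2 := by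
  by_cases h : -1 ≤ x
  · have := abs_le.1 (Real.abs_exp_sub_one_sub_id_le (abs_le.2 ⟨h, hx⟩))
    linarith [this.2]
  · have : Real.exp x ≤ 1 := Real.exp_le_one_iff.2 (by linarith)
    nlinarith

/-- If `Z` has mean zero and `W ≤ exp Z`, then the mean of `W` is at most one plus the variance
of `Z`, up to the contribution of the event `1 < Z`. -/
theorem sum_le_card_add_sum_sq_add_tail {Ω : Type*} [Fintype Ω] (Z W : Ω → ℝ)
    (hZ : ∑ ω, Z ω = 0) (hW : ∀ ω, W ω ≤ Real.exp (Z ω)) :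
    ∑ ω, W ω ≤ Fintype.card Ω + ∑ ω, Z ω ^ 2 + ∑ ω, if 1 < Z ω then W ω else 0 := by
  have h : ∀ ω, W ω ≤ 1 + Z ω + Z ω ^ 2 + if 1 < Z ω then W ω else 0 := by
    intro ω
    split_ifs with h
    · nlinarith [sq_nonneg (Z ω)]
    · have := exp_le_one_add_add_sq (not_lt.1 h)
      linarith [hW ω]
  calc ∑ ω, W ω ≤ ∑ ω, (1 + Z ω + Z ω ^ 2 + if 1 < Z ω then W ω else 0) :=
        Finset.sum_le_sum fun ω _ => h ω
    _ = _ := by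
      rw [Finset.sum_add_distrib, Finset.sum_add_distrib, Finset.sum_add_distrib, hZ]
      simp

/-- The deviation, scaled by `T`, of the probability that a random scope lies inside a set of `j`
variables from its mean `d ^ (-k)` over a random agreement set. -/
noncomputable def overlapDev (n d k : ℕ) (T : ℝ) (j : ℕ) : ℝ :=
  T * ((j.choose k : ℝ) / (n.choose k : ℝ) - 1 / (d : ℝ) ^ k)

theorem sum_overlapDev (σ : Fin n → Fin d) (hd : 0 < d) (hkn : k ≤ n) (T : ℝ) :
    ∑ σ' : Fin n → Fin d, overlapDev n d k T (agreeSet σ σ').card = 0 := by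
  have hd' : (0 : ℝ) < d := by exact_mod_cast hd
  have hc : (0 : ℝ) < n.choose k := by exact_mod_cast Nat.choose_pos hkn
  simp only [overlapDev]
  rw [← Finset.mul_sum, Finset.sum_sub_distrib, ← Finset.sum_div,
    eq_div_of_mul_eq (by positivity) (sum_choose_agreeSet (k := k) σ hkn)]
  simp only [Finset.sum_const, Finset.card_univ, Fintype.card_fun, Fintype.card_fin, nsmul_eq_mul,
    Nat.cast_pow]
  field_simp
  ring

theorem sum_overlapDev_sq_le (σ : Fin n → Fin d) (hd : 0 < d) (hkn : k ≤ n) (T : ℝ) :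
    ∑ σ' : Fin n → Fin d, overlapDev n d k T (agreeSet σ σ').card ^ 2
      ≤ (d : ℝ) ^ n * (T ^ 2 * ((1 + (d : ℝ) * k / n) ^ k - 1) / (d : ℝ) ^ (2 * k)) := by
  have hd' : (0 : ℝ) < d := by exact_mod_cast hd
  have hc : (0 : ℝ) < n.choose k := by exact_mod_cast Nat.choose_pos hkn
  have h1 := eq_div_of_mul_eq (by positivity) (sum_choose_agreeSet (k := k) σ hkn)
  have h2 := (le_div_iff₀ (by positivity)).2 (sum_choose_agreeSet_sq_le (k := k) σ hd hkn)
  have h3 : ∑ σ' : Fin n → Fin d, overlapDev n d k T (agreeSet σ σ').card ^ 2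
      = T ^ 2 * ((∑ σ' : Fin n → Fin d, ((agreeSet σ σ').card.choose k : ℝ) ^ 2)
          / (n.choose k : ℝ) ^ 2
        - 2 / (d : ℝ) ^ k / n.choose k * (∑ σ' : Fin n → Fin d, ((agreeSet σ σ').card.choose k : ℝ))
        + (d : ℝ) ^ n / (d : ℝ) ^ (2 * k)) := by
    have : ∀ σ' : Fin n → Fin d, overlapDev n d k T (agreeSet σ σ').card ^ 2
        = T ^ 2 * (((agreeSet σ σ').card.choose k : ℝ) ^ 2 / (n.choose k : ℝ) ^ 2
        - 2 / (d : ℝ) ^ k / n.choose k * ((agreeSet σ σ').card.choose k : ℝ)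
        + 1 / (d : ℝ) ^ (2 * k)) := by
      intro σ'
      rw [overlapDev, pow_mul' (d : ℝ) 2 k]
      field_simp
      ring
    simp only [this]
    rw [← Finset.mul_sum, Finset.sum_add_distrib, Finset.sum_sub_distrib, ← Finset.sum_div,
      ← Finset.mul_sum]
    simp only [Finset.sum_const, Finset.card_univ, Fintype.card_fun, Fintype.card_fin,
      nsmul_eq_mul, Nat.cast_pow]
    ring
  rw [h3, h1, mul_div_assoc (T ^ 2), mul_left_comm ((d : ℝ) ^ n)]
  refine mul_le_mul_of_nonneg_left ?_ (sq_nonneg T)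
  have h4 := div_le_div_of_nonneg_right h2 (by positivity : (0 : ℝ) ≤ (n.choose k : ℝ) ^ 2)
  have h5 : (d : ℝ) ^ n * (n.choose k : ℝ) ^ 2 * (1 + (d : ℝ) * k / n) ^ k / (d : ℝ) ^ (2 * k)
      / (n.choose k : ℝ) ^ 2 = (d : ℝ) ^ n * (1 + (d : ℝ) * k / n) ^ k / (d : ℝ) ^ (2 * k) := by
    field_simp
  have h6 : 2 / (d : ℝ) ^ k / n.choose k * ((n.choose k : ℝ) * (d : ℝ) ^ n / (d : ℝ) ^ k)
      = 2 * ((d : ℝ) ^ n / (d : ℝ) ^ (2 * k)) := by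
    rw [pow_mul' (d : ℝ) 2 k]
    field_simp
  rw [h5] at h4
  rw [h6]
  calc _ ≤ (d : ℝ) ^ n * (1 + (d : ℝ) * k / n) ^ k / (d : ℝ) ^ (2 * k)
        - 2 * ((d : ℝ) ^ n / (d : ℝ) ^ (2 * k)) + (d : ℝ) ^ n / (d : ℝ) ^ (2 * k) := by linarith
    _ = _ := by ring

/-- The mean of a weight `W` of the number of agreements with `σ`, when the weight is below
`exp (overlapDev …)` and is beaten by the Chernoff bound wherever `1 < overlapDev …`. -/
theorem sum_weight_agreeSet_le (σ : Fin n → Fin d) (hd : 0 < d) (hk : 0 < k) (hkn : k ≤ n)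
    {T ε : ℝ} (hT : 0 ≤ T) (W : ℕ → ℝ) (hW0 : ∀ j ≤ n, 0 ≤ W j)
    (hW : ∀ j ≤ n, W j ≤ Real.exp (overlapDev n d k T j))
    (htail : ∀ j ≤ n, 0 < j → 1 < overlapDev n d k T j →
      Real.exp (-(j * Real.log (j * d / n)) + j - n / d) * W j ≤ ε) (hε : 0 ≤ ε) :
    ∑ σ' : Fin n → Fin d, W (agreeSet σ σ').card
      ≤ (d : ℝ) ^ n * (1 + T ^ 2 * ((1 + (d : ℝ) * k / n) ^ k - 1) / (d : ℝ) ^ (2 * k)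
        + (n + 1) * ε) := by
  have hle : ∀ σ' : Fin n → Fin d, (agreeSet σ σ').card ≤ n := fun σ' =>
    (Finset.card_le_univ _).trans (by simp)
  have h1 := sum_le_card_add_sum_sq_add_tail
    (fun σ' : Fin n → Fin d => overlapDev n d k T (agreeSet σ σ').card)
    (fun σ' => W (agreeSet σ σ').card) (sum_overlapDev σ hd hkn T) (fun σ' => hW _ (hle σ'))
  have h2 := sum_overlapDev_sq_le σ hd hkn T
  have h3 : (∑ σ' : Fin n → Fin d,
      if 1 < overlapDev n d k T (agreeSet σ σ').card then W (agreeSet σ σ').card else 0)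
      ≤ (d : ℝ) ^ n * ((n + 1) * ε) := by
    have h4 : ∀ j ∈ Finset.range (n + 1), (∑ σ' : Fin n → Fin d, if (agreeSet σ σ').card = j then
        (if 1 < overlapDev n d k T j then W j else 0) else 0) ≤ (d : ℝ) ^ n * ε := by
      intro j hj
      have hjn : j ≤ n := Nat.lt_succ_iff.1 (Finset.mem_range.1 hj)
      rw [← Finset.sum_filter, Finset.sum_const, nsmul_eq_mul]
      split_ifs with h
      · have hj0 : 0 < j := by
          rcases Nat.eq_zero_or_pos j with rfl | h0
          · exfalso
            rw [overlapDev, Nat.choose_eq_zero_of_lt hk] at h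
            have : 0 ≤ T * (1 / (d : ℝ) ^ k) := by positivity
            simp only [Nat.cast_zero, zero_div, zero_sub, mul_neg] at h
            linarith
          · exact h0
        calc _ ≤ ((d : ℝ) ^ n * Real.exp (-(j * Real.log (j * d / n)) + j - n / d)) * W j :=
              mul_le_mul_of_nonneg_right (card_agreeSet_card_eq_le σ hd hj0 hjn) (hW0 j hjn)
          _ = (d : ℝ) ^ n * (Real.exp (-(j * Real.log (j * d / n)) + j - n / d) * W j) := by ring
          _ ≤ _ := mul_le_mul_of_nonneg_left (htail j hjn hj0 h) (by positivity)
      · rw [mul_zero]; positivity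
    have h5 : (∑ σ' : Fin n → Fin d,
        if 1 < overlapDev n d k T (agreeSet σ σ').card then W (agreeSet σ σ').card else 0)
        = ∑ j ∈ Finset.range (n + 1), ∑ σ' : Fin n → Fin d, if (agreeSet σ σ').card = j then
        (if 1 < overlapDev n d k T j then W j else 0) else 0 := by
      rw [Finset.sum_comm]
      refine Finset.sum_congr rfl fun σ' _ => ?_
      rw [Finset.sum_ite_eq, if_pos (Finset.mem_range.2 (Nat.lt_succ_iff.2 (hle σ')))]
    rw [h5]
    refine (Finset.sum_le_sum h4).trans (le_of_eq ?_)
    simp; ring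
  simp only [Fintype.card_fun, Fintype.card_fin, Nat.cast_pow] at h1
  linarith

/-! ### The normalised second moment -/

theorem choose_pred_mul (N q : ℕ) (hN : 0 < N) (hq : q ≤ N) :
    ((N - 1).choose q : ℝ) * N = (N.choose q : ℝ) * ((N : ℝ) - q) := by
  obtain ⟨m, rfl⟩ : ∃ m, N = m + 1 := ⟨N - 1, by omega⟩
  rw [← Nat.cast_sub hq]
  exact_mod_cast Nat.choose_mul_succ_eq m q

/-- The second moment bound in normalised form. The ratio of the joint to the product probability
that two assignments satisfy a constraint is affine in the probability that the scope lies in their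
agreement set, and it equals one at the mean `d ^ (-k)` of that probability. -/
theorem one_le_satProb_mul (hd : 0 < d) (hkn : k ≤ n) (hN : 2 ≤ d ^ k) (hq : q < d ^ k) {c η : ℝ}
    (hc : c = (q : ℝ) * (d : ℝ) ^ k / (((d : ℝ) ^ k - q) * ((d : ℝ) ^ k - 1)))
    (h : ∀ σ : Fin n → Fin d, ∑ σ' : Fin n → Fin d,
      (1 + c * (((agreeSet σ σ').card.choose k : ℝ) / (n.choose k : ℝ) - 1 / (d : ℝ) ^ k)) ^ t
        ≤ (d : ℝ) ^ n * (1 + η)) :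
    1 ≤ satProb n d k q t * (1 + η) := by
  have hd' : (0 : ℝ) < d := by exact_mod_cast hd
  set N := d ^ k with hNdef
  have hNr : (d : ℝ) ^ k = (N : ℝ) := by rw [hNdef]; push_cast; rfl
  rw [hNr] at hc h
  have hN2 : (2 : ℝ) ≤ N := by exact_mod_cast hN
  have hqN : (q : ℝ) + 1 ≤ N := by exact_mod_cast hq
  have hb : (0 : ℝ) < n.choose k := by exact_mod_cast Nat.choose_pos hkn
  have hC : (0 : ℝ) < N.choose q := by exact_mod_cast Nat.choose_pos hq.le
  have e1 := choose_pred_mul N q (by omega) hq.le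
  have e2 := choose_pred_mul (N - 1) q (by omega) (by omega)
  rw [Nat.sub_sub, Nat.cast_sub (by omega : 1 ≤ N), Nat.cast_one] at e2
  have hC1 : (0 : ℝ) < (N - 1).choose q := by
    exact_mod_cast Nat.choose_pos (by omega : q ≤ N - 1)
  set a : ℝ := (n.choose k : ℝ) * ((N - 1).choose q : ℝ) with ha
  set Q : ℝ := (n.choose k : ℝ) * (N.choose q : ℝ) with hQ
  have ha0 : 0 < a := by positivity
  have f1 : ((N - 1).choose q : ℝ) = (N.choose q : ℝ) * ((N : ℝ) - q) / N :=
    eq_div_of_mul_eq (by positivity) e1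
  have f2 : ((N - 2).choose q : ℝ) = ((N - 1).choose q : ℝ) * ((N : ℝ) - 1 - q) / (N - 1) :=
    eq_div_of_mul_eq (by linarith) e2
  have hNq : (N : ℝ) - q ≠ 0 := by linarith
  have hN1 : (N : ℝ) - 1 ≠ 0 := by linarith
  have hN0 : (N : ℝ) ≠ 0 := by linarith
  have key : ∀ S : ℝ, Q * (S * ((N - 1).choose q : ℝ)
      + ((n.choose k : ℝ) - S) * ((N - 2).choose q : ℝ))
      = a ^ 2 * (1 + c * (S / (n.choose k : ℝ) - 1 / (N : ℝ))) := by
    intro S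
    rw [f2, ha, hQ, hc, f1]
    field_simp
    ring
  have h1 := first_moment_sq_le (n := n) (d := d) (k := k) (q := q) (t := t)
  rw [sum_numSolutions, sum_numSolutions_sq, ← hNdef, mul_assoc, Finset.mul_sum] at h1
  have h2 : ∀ σ : Fin n → Fin d, (Q ^ t * ∑ σ' : Fin n → Fin d,
      (((agreeSet σ σ').card.choose k : ℝ) * ((N - 1).choose q : ℝ)
        + ((n.choose k : ℝ) - ((agreeSet σ σ').card.choose k : ℝ)) * ((N - 2).choose q : ℝ)) ^ t)
      ≤ (a ^ 2) ^ t * ((d : ℝ) ^ n * (1 + η)) := by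
    intro σ
    rw [Finset.mul_sum]
    simp only [← mul_pow, key]
    simp only [mul_pow]
    rw [← Finset.mul_sum]
    exact mul_le_mul_of_nonneg_left (h σ) (by positivity)
  have h3 := h1.trans (mul_le_mul_of_nonneg_left (Finset.sum_le_sum fun σ _ => h2 σ)
    satProb_nonneg)
  simp only [Finset.sum_const, Finset.card_univ, Fintype.card_fun, Fintype.card_fin, nsmul_eq_mul,
    Nat.cast_pow] at h3
  have hpos : 0 < ((d : ℝ) ^ n * a ^ t) ^ 2 := by positivity
  refine le_of_mul_le_mul_left ?_ hpos
  calc _ = ((d : ℝ) ^ n * a ^ t) ^ 2 := mul_one _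
    _ ≤ _ := h3
    _ = _ := by ring

/-! ### The inequality behind the condition on `k` -/

/-- The hypothesis `k ≥ τ log τ / (τ - 1)` says `y ≤ k (1 - exp (-y))` at `y = log τ`, and by
concavity of the right-hand side the inequality persists below. -/
theorem le_mul_one_sub_exp_neg {L κ y : ℝ} (hL : 0 < L) (hκ : L ≤ κ * (1 - Real.exp (-L)))
    (hy0 : 0 ≤ y) (hyL : y ≤ L) : y ≤ κ * (1 - Real.exp (-y)) := by
  have h1 := convexOn_exp.2 (Set.mem_univ (-L)) (Set.mem_univ 0)
    (div_nonneg hy0 hL.le) (sub_nonneg.2 ((div_le_one hL).2 hyL)) (add_sub_cancel _ _)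
  have h2 : y / L * -L = -y := by field_simp
  simp only [smul_eq_mul, mul_zero, add_zero, Real.exp_zero, mul_one, h2] at h1
  have hE : Real.exp (-L) < 1 := by
    rw [← Real.exp_zero]; exact Real.exp_lt_exp.2 (by linarith)
  have hκ0 : 0 ≤ κ := by
    by_contra hneg
    nlinarith
  calc y = y / L * L := by field_simp
    _ ≤ y / L * (κ * (1 - Real.exp (-L))) := by gcongr
    _ = κ * (y / L * (1 - Real.exp (-L))) := by ring
    _ ≤ κ * (1 - Real.exp (-y)) := by
      refine mul_le_mul_of_nonneg_left ?_ hκ0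
      linarith

/-- Two assignments agreeing on a proportion `s` of the variables contribute
`(1 + (exp y - 1) s ^ k) ^ t` to the second moment, and this inequality makes it
negligible against the number of such pairs. It expresses that `(exp (y s) - 1) / s ^ k` is
nonincreasing on `(0, 1]`. -/
theorem one_add_mul_pow_le_exp {L y s : ℝ} {k : ℕ}
    (hL : 0 < L) (hκ : L ≤ k * (1 - Real.exp (-L))) (hy0 : 0 ≤ y) (hyL : y ≤ L)
    (hs0 : 0 < s) (hs1 : s ≤ 1) :
    1 + (Real.exp y - 1) * s ^ k ≤ Real.exp (y * s) := by
  have hderiv : ∀ x : ℝ, 0 < x → HasDerivAt (fun u : ℝ => (Real.exp (y * u) - 1) / u ^ k)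
      ((Real.exp (y * x) * y * x ^ k - (Real.exp (y * x) - 1) * (k * x ^ (k - 1)))
        / (x ^ k) ^ 2) x := by
    intro x hx
    have h1 : HasDerivAt (fun u : ℝ => Real.exp (y * u) - 1) (Real.exp (y * x) * y) x := by
      have := ((hasDerivAt_id x).const_mul y).exp.sub_const 1
      simpa using this
    exact h1.div (hasDerivAt_pow k x) (by positivity)
  have hanti : AntitoneOn (fun u : ℝ => (Real.exp (y * u) - 1) / u ^ k) (Set.Icc s 1) := by
    refine antitoneOn_of_deriv_nonpos (convex_Icc s 1) ?_ ?_ ?_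
    · intro x hx
      exact (hderiv x (hs0.trans_le hx.1)).continuousAt.continuousWithinAt
    · intro x hx
      rw [interior_Icc] at hx
      exact (hderiv x (hs0.trans hx.1)).differentiableAt.differentiableWithinAt
    · intro x hx
      rw [interior_Icc] at hx
      have hx0 : 0 < x := hs0.trans hx.1
      rw [(hderiv x hx0).deriv]
      refine div_nonpos_of_nonpos_of_nonneg ?_ (by positivity)
      have hk : k ≠ 0 := by
        rintro rfl
        simp at hκ; linarith
      have h1 := le_mul_one_sub_exp_neg hL hκ (mul_nonneg hy0 hx0.le)
        ((mul_le_of_le_one_right hy0 hx.2.le).trans hyL)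
      have h2 : Real.exp (y * x) * Real.exp (-(y * x)) = 1 := by
        rw [← Real.exp_add]; simp
      have h3 : Real.exp (y * x) * (y * x) ≤ k * (Real.exp (y * x) - 1) := by
        have := mul_le_mul_of_nonneg_left h1 (Real.exp_pos (y * x)).le
        calc _ ≤ _ := this
          _ = k * (Real.exp (y * x) - Real.exp (y * x) * Real.exp (-(y * x))) := by ring
          _ = _ := by rw [h2]
      obtain ⟨m, rfl⟩ := Nat.exists_eq_succ_of_ne_zero hk
      have h4 : 0 ≤ x ^ m := by positivity
      have h5 := mul_le_mul_of_nonneg_left h3 h4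
      simp only [Nat.succ_eq_add_one, Nat.add_sub_cancel, pow_succ] at h5 ⊢
      nlinarith
  have h := hanti (Set.left_mem_Icc.2 hs1) (Set.right_mem_Icc.2 hs1) hs1
  simp only [mul_one, one_pow, div_one] at h
  rw [le_div_iff₀ (by positivity)] at h
  linarith

/-! ### Large agreement sets -/

theorem choose_div_choose_le (hkn : k ≤ n) {j : ℕ} (hj : j ≤ n) :
    (j.choose k : ℝ) / (n.choose k : ℝ) ≤ ((j : ℝ) / n) ^ k := by
  have h : ∀ i ≤ n, j.descFactorial i * n ^ i ≤ n.descFactorial i * j ^ i := by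
    intro i hi
    induction i with
    | zero => simp
    | succ i ih =>
      rw [Nat.descFactorial_succ, Nat.descFactorial_succ, pow_succ, pow_succ]
      have h1 : (j - i) * n ≤ (n - i) * j := by
        rw [Nat.sub_mul, Nat.sub_mul, mul_comm n j]
        exact Nat.sub_le_sub_left (Nat.mul_le_mul_left i hj) _
      calc (j - i) * j.descFactorial i * (n ^ i * n)
          = ((j - i) * n) * (j.descFactorial i * n ^ i) := by ring
        _ ≤ ((n - i) * j) * (n.descFactorial i * j ^ i) := Nat.mul_le_mul h1 (ih (by omega))
        _ = _ := by ring
  have h1 := h k hkn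
  rw [Nat.descFactorial_eq_factorial_mul_choose, Nat.descFactorial_eq_factorial_mul_choose,
    mul_assoc, mul_assoc] at h1
  have h2 := Nat.le_of_mul_le_mul_left h1 (Nat.factorial_pos k)
  have hc : (0 : ℝ) < n.choose k := by exact_mod_cast Nat.choose_pos hkn
  rcases Nat.eq_zero_or_pos n with rfl | hn
  · obtain rfl : k = 0 := by omega
    simp
  have hn' : (0 : ℝ) < n := by exact_mod_cast hn
  rw [div_pow, div_le_div_iff₀ hc (by positivity), mul_comm ((j : ℝ) ^ k)]
  exact_mod_cast h2

theorem overlapDev_le (hkn : k ≤ n) {j : ℕ} (hj : j ≤ n) {T : ℝ} (hT : 0 ≤ T) :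
    overlapDev n d k T j ≤ T * (((j : ℝ) / n) ^ k - 1 / (d : ℝ) ^ k) :=
  mul_le_mul_of_nonneg_left (sub_le_sub_right (choose_div_choose_le hkn hj) _) hT

theorem pow_sub_one_le {u b : ℝ} (hu : 1 ≤ u) (hub : u ≤ b) (k : ℕ) :
    u ^ k - 1 ≤ k * b ^ k * (u - 1) := by
  rw [← geom_sum_mul]
  refine mul_le_mul_of_nonneg_right ?_ (by linarith)
  calc ∑ i ∈ Finset.range k, u ^ i ≤ ∑ i ∈ Finset.range k, b ^ k := by
        refine Finset.sum_le_sum fun i hi => ?_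
        calc u ^ i ≤ u ^ k := pow_le_pow_right₀ hu (Finset.mem_range.1 hi).le
          _ ≤ b ^ k := by gcongr
    _ = _ := by simp

theorem sq_div_le_mul_log {u : ℝ} (hu : 1 ≤ u) :
    (u - 1) ^ 2 / (u + 1) ≤ u * Real.log u - u + 1 := by
  have h := Real.le_log_one_add_of_nonneg (x := u - 1) (by linarith)
  have e : 1 + (u - 1) = u := by ring
  have e' : u - 1 + 2 = u + 1 := by ring
  rw [e, e'] at h
  have h1 := mul_le_mul_of_nonneg_left h (by linarith : (0 : ℝ) ≤ u)
  have h2 : u * (2 * (u - 1) / (u + 1)) - u + 1 = (u - 1) ^ 2 / (u + 1) := by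
    have : u + 1 ≠ 0 := by linarith
    field_simp
    ring
  linarith

/-- Agreement sets of atypical size `j` are negligible: the Chernoff bound beats the weight `W`.
If `j` is within a constant factor of its mean `n / d`, this is the quadratic behaviour of the rate
function; between there and `n * d ^ (-δ)` the rate is at least `j` while the weight is at most
`exp (j / 2)`; beyond, the weight is at most `exp (θ j log d)` with `θ < 1`. -/
theorem exp_rate_mul_weight_le {j : ℕ} (hd : 0 < d) (hk : 2 ≤ k) (hkn : k ≤ n) (hj0 : 0 < j)
    (hjn : j ≤ n) {T Λ θ δ C₀ W : ℝ} (hT : 0 ≤ T) (hΛ : 1 ≤ Λ) (hC₀ : 0 ≤ C₀)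
    (hZ : 1 < overlapDev n d k T j)
    (hW : W ≤ Real.exp (overlapDev n d k T j))
    (hW' : W ≤ Real.exp (θ * j * Real.log d + C₀))
    (hnear : 18 * (T / (d : ℝ) ^ k * (k * 8 ^ k)) ^ 2 * Λ ≤ n / d)
    (hmid : T * (d : ℝ) ^ (-δ) ≤ n / 2)
    (hsize : T * (2 * Λ + C₀) ^ 2 ≤ (n : ℝ) ^ 2)
    (hfar : 2 ≤ (1 - δ - θ) * Real.log d) :
    Real.exp (-(j * Real.log (j * d / n)) + j - n / d) * W ≤ Real.exp (-Λ) := by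
  have hd' : (0 : ℝ) < d := by exact_mod_cast hd
  have hd1 : (1 : ℝ) ≤ d := by exact_mod_cast hd
  have hj' : (0 : ℝ) < j := by exact_mod_cast hj0
  have hn' : (0 : ℝ) < n := by exact_mod_cast hj0.trans_le hjn
  have hjn' : (j : ℝ) / n ≤ 1 := (div_le_one hn').2 (by exact_mod_cast hjn)
  have hZle := overlapDev_le (d := d) hkn hjn hT
  set Z := overlapDev n d k T j
  set u : ℝ := j * d / n with hu
  have hjM : (j : ℝ) = n / d * u := by rw [hu]; field_simp
  have hsu : (j : ℝ) / n = u / d := by rw [hu]; field_simp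
  have hZB : Z ≤ T / (d : ℝ) ^ k * (u ^ k - 1) := by
    refine hZle.trans (le_of_eq ?_)
    rw [hsu, div_pow]; ring
  have hB : 0 ≤ T / (d : ℝ) ^ k := by positivity
  have hu0 : 0 < u := by positivity
  have hZs : Z ≤ T * ((j : ℝ) / n) ^ k := by
    refine hZle.trans (mul_le_mul_of_nonneg_left ?_ hT)
    have : (0 : ℝ) ≤ 1 / (d : ℝ) ^ k := by positivity
    linarith
  have hu1 : 1 < u := by
    by_contra hcon
    have h1 := pow_le_one₀ (n := k) hu0.le (not_lt.1 hcon)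
    have h2 := mul_nonpos_of_nonneg_of_nonpos hB (sub_nonpos.2 h1)
    linarith
  -- The deviation can exceed one only if `j` is large.
  have hjbig : 2 * Λ + C₀ ≤ j := by
    by_contra hcon
    have hlt := not_le.1 hcon
    have h1 : ((j : ℝ) / n) ^ k ≤ ((j : ℝ) / n) ^ 2 :=
      pow_le_pow_of_le_one (by positivity) hjn' hk
    have h2 : T * ((j : ℝ) / n) ^ 2 ≤ 1 := by
      rw [div_pow, ← mul_div_assoc, div_le_one (by positivity)]
      refine le_trans ?_ hsize
      gcongr
    have h3 := mul_le_mul_of_nonneg_left h1 hT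
    linarith
  -- Any bound with logarithm at least two would do in place of `8`: it makes the rate at least `j`.
  rcases le_total u 8 with hu8 | hu8
  · have h1 := pow_sub_one_le hu1.le hu8 k
    set y : ℝ := T / (d : ℝ) ^ k * (k * 8 ^ k) * (u - 1) with hy
    have hZy : Z ≤ y := by
      refine hZB.trans ((mul_le_mul_of_nonneg_left h1 hB).trans (le_of_eq ?_))
      rw [hy]; ring
    have hy1 : 1 < y := hZ.trans_le hZy
    have h2 : 18 * y ^ 2 * Λ ≤ n / d * (u - 1) ^ 2 := by
      have := mul_le_mul_of_nonneg_right hnear (sq_nonneg (u - 1))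
      calc _ = 18 * (T / (d : ℝ) ^ k * (k * 8 ^ k)) ^ 2 * Λ * (u - 1) ^ 2 := by rw [hy]; ring
        _ ≤ _ := this
    have h3 : n / d * ((u - 1) ^ 2 / 9) ≤ n / d * (u * Real.log u - u + 1) := by
      refine mul_le_mul_of_nonneg_left (le_trans ?_ (sq_div_le_mul_log hu1.le)) (by positivity)
      exact div_le_div_of_nonneg_left (sq_nonneg _) (by linarith) (by linarith)
    have h4 : y + Λ ≤ 2 * y ^ 2 * Λ := by
      have h5 : y ≤ y ^ 2 := le_self_pow₀ hy1.le two_ne_zero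
      have h6 : y ^ 2 ≤ y ^ 2 * Λ := le_mul_of_one_le_right (sq_nonneg y) hΛ
      have h7 : Λ ≤ y ^ 2 * Λ := le_mul_of_one_le_left (by linarith) (one_le_pow₀ hy1.le)
      linarith
    calc _ ≤ Real.exp (-(j * Real.log u) + j - n / d) * Real.exp y := by
          gcongr
          exact hW.trans (Real.exp_le_exp.2 hZy)
      _ = Real.exp (-(n / d * (u * Real.log u - u + 1)) + y) := by
          rw [← Real.exp_add]
          congr 1
          rw [hjM]; ring
      _ ≤ _ := Real.exp_le_exp.2 (by linarith)
  · have hM : (0 : ℝ) ≤ n / d := by positivity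
    rcases le_total ((j : ℝ) / n) ((d : ℝ) ^ (-δ)) with hs | hs
    · have hlog : 2 ≤ Real.log u := by
        have h8 : Real.log 8 = 3 * Real.log 2 := by
          rw [show (8 : ℝ) = 2 ^ 3 by norm_num, Real.log_pow]; norm_num
        have := Real.log_two_gt_d9
        have := Real.log_le_log (by norm_num) hu8
        linarith
      have h1 : Z ≤ j / 2 := by
        have h2 : ((j : ℝ) / n) ^ k ≤ (j : ℝ) / n * (d : ℝ) ^ (-δ) := by
          calc ((j : ℝ) / n) ^ k ≤ ((j : ℝ) / n) ^ 2 :=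
                pow_le_pow_of_le_one (by positivity) hjn' hk
            _ = (j : ℝ) / n * ((j : ℝ) / n) := sq _
            _ ≤ _ := by gcongr
        calc Z ≤ T * ((j : ℝ) / n * (d : ℝ) ^ (-δ)) :=
              hZs.trans (mul_le_mul_of_nonneg_left h2 hT)
          _ = (j : ℝ) / n * (T * (d : ℝ) ^ (-δ)) := by ring
          _ ≤ (j : ℝ) / n * (n / 2) := by gcongr
          _ = j / 2 := by field_simp
      have h3 := mul_le_mul_of_nonneg_left hlog hj'.le
      calc _ ≤ Real.exp (-(j * Real.log u) + j - n / d) * Real.exp (j / 2) := by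
            gcongr
            exact hW.trans (Real.exp_le_exp.2 h1)
        _ = Real.exp (-(j * Real.log u) + j - n / d + j / 2) := by rw [← Real.exp_add]
        _ ≤ _ := Real.exp_le_exp.2 (by linarith)
    · have hlog : (1 - δ) * Real.log d ≤ Real.log u := by
        have h1 : (d : ℝ) ^ (1 - δ) ≤ u := by
          have h2 : u = (j : ℝ) / n * d := by rw [hu]; ring
          rw [h2, sub_eq_neg_add, Real.rpow_add hd', Real.rpow_one]
          gcongr
        rw [← Real.log_rpow hd']
        exact Real.log_le_log (by positivity) h1
      have h3 := mul_le_mul_of_nonneg_left hlog hj'.le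
      have h4 := mul_le_mul_of_nonneg_left hfar hj'.le
      calc _ ≤ Real.exp (-(j * Real.log u) + j - n / d)
              * Real.exp (θ * j * Real.log d + C₀) := by gcongr
        _ = Real.exp (-(j * Real.log u) + j - n / d + (θ * j * Real.log d + C₀)) := by
            rw [← Real.exp_add]
        _ ≤ _ := Real.exp_le_exp.2 (by linarith)

end ModelRB

namespace ModelRB

variable {α : ℝ} {d : ℕ → ℕ}

/-! ### Asymptotics of the rounded parameters -/

theorem IsRounding.le_add_one {m : ℕ} {x : ℝ} (h : IsRounding m x) (hx : 0 ≤ x) :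
    (m : ℝ) ≤ x + 1 := by
  rcases h with rfl | rfl
  · linarith [Nat.floor_le hx]
  · exact (Nat.ceil_lt_add_one hx).le

theorem IsRounding.sub_one_le {m : ℕ} {x : ℝ} (h : IsRounding m x) : x - 1 ≤ (m : ℝ) := by
  rcases h with rfl | rfl
  · exact (Nat.sub_one_lt_floor x).le
  · linarith [Nat.le_ceil x]

theorem tendsto_rpow_natCast (hα : 0 < α) :
    Tendsto (fun n : ℕ => (n : ℝ) ^ α) atTop atTop :=
  (tendsto_rpow_atTop hα).comp tendsto_natCast_atTop_atTop

theorem eventually_half_rpow_le (hα : 0 < α) (hd : ∀ n : ℕ, IsRounding (d n) ((n : ℝ) ^ α)) :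
    ∀ᶠ n : ℕ in atTop, (n : ℝ) ^ α / 2 ≤ d n := by
  filter_upwards [(tendsto_rpow_natCast hα).eventually_ge_atTop 2] with n hn
  linarith [(hd n).sub_one_le]

theorem eventually_le_two_mul_rpow (hα : 0 < α)
    (hd : ∀ n : ℕ, IsRounding (d n) ((n : ℝ) ^ α)) :
    ∀ᶠ n : ℕ in atTop, (d n : ℝ) ≤ 2 * (n : ℝ) ^ α := by
  filter_upwards [(tendsto_rpow_natCast hα).eventually_ge_atTop 2] with n hn
  linarith [(hd n).le_add_one (by positivity)]

theorem tendsto_domain (hα : 0 < α) (hd : ∀ n : ℕ, IsRounding (d n) ((n : ℝ) ^ α)) :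
    Tendsto (fun n => (d n : ℝ)) atTop atTop :=
  tendsto_atTop_mono' _ (eventually_half_rpow_le hα hd)
    ((tendsto_rpow_natCast hα).atTop_div_const two_pos)

theorem tendsto_log_domain (hα : 0 < α) (hd : ∀ n : ℕ, IsRounding (d n) ((n : ℝ) ^ α)) :
    Tendsto (fun n => Real.log (d n : ℝ)) atTop atTop :=
  Real.tendsto_log_atTop.comp (tendsto_domain hα hd)

theorem eventually_log_domain_le (hα : 0 < α)
    (hd : ∀ n : ℕ, IsRounding (d n) ((n : ℝ) ^ α)) :
    ∀ᶠ n : ℕ in atTop, Real.log (d n : ℝ) ≤ (α + 1) * Real.log n := by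
  filter_upwards [eventually_le_two_mul_rpow hα hd,
    (tendsto_domain hα hd).eventually_ge_atTop 1, eventually_ge_atTop 2] with n h1 h2 h3
  have hn : (2 : ℝ) ≤ n := by exact_mod_cast h3
  have hn0 : (0 : ℝ) < n := by linarith
  rw [← Real.log_rpow hn0]
  refine Real.log_le_log (by linarith) (h1.trans ?_)
  rw [Real.rpow_add hn0, Real.rpow_one, mul_comm]
  gcongr

theorem tendsto_log_pow_mul_rpow (m : ℕ) {β : ℝ} (hβ : β < 0) :
    Tendsto (fun n : ℕ => Real.log n ^ m * (n : ℝ) ^ β) atTop (𝓝 0) := by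
  have h := (isLittleO_log_rpow_rpow_atTop (m : ℝ) (neg_pos.2 hβ)).tendsto_div_nhds_zero
  refine (h.comp tendsto_natCast_atTop_atTop).congr' ?_
  filter_upwards [eventually_ge_atTop 1] with n hn
  simp only [Function.comp_apply]
  rw [Real.rpow_neg (Nat.cast_nonneg n), div_inv_eq_mul, Real.rpow_natCast]

/-- Powers of `log n` do not affect the decay of `n ^ β * d ^ (-γ)`, where `d` is of order
`n ^ α`. -/
theorem tendsto_log_pow_mul_rpow_mul_domain (hα : 0 < α)
    (hd : ∀ n : ℕ, IsRounding (d n) ((n : ℝ) ^ α)) (m : ℕ) {β γ : ℝ} (hγ : 0 ≤ γ)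
    (hβ : β < α * γ) :
    Tendsto (fun n : ℕ => Real.log n ^ m * (n : ℝ) ^ β * (d n : ℝ) ^ (-γ)) atTop (𝓝 0) := by
  have h := (tendsto_log_pow_mul_rpow m (sub_neg.2 hβ)).const_mul ((2 : ℝ) ^ γ)
  rw [mul_zero] at h
  refine squeeze_zero' (Eventually.of_forall fun n => ?_) ?_ h
  · have : 0 ≤ Real.log (n : ℝ) := Real.log_natCast_nonneg n
    positivity
  · filter_upwards [eventually_half_rpow_le hα hd, eventually_ge_atTop 1] with n h1 h2
    have hn : (0 : ℝ) < n := by exact_mod_cast h2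
    have hl : 0 ≤ Real.log (n : ℝ) := Real.log_natCast_nonneg n
    have hpos : 0 < (n : ℝ) ^ α / 2 := by positivity
    have h3 : (d n : ℝ) ^ (-γ) ≤ ((n : ℝ) ^ α / 2) ^ (-γ) :=
      Real.rpow_le_rpow_of_nonpos hpos h1 (by linarith)
    have h4 : ((n : ℝ) ^ α / 2) ^ (-γ) = (2 : ℝ) ^ γ * (n : ℝ) ^ (-(α * γ)) := by
      rw [Real.div_rpow (by positivity) (by norm_num), ← Real.rpow_mul hn.le,
        Real.rpow_neg (by norm_num : (0 : ℝ) ≤ 2), div_inv_eq_mul, mul_neg, mul_comm]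
    calc Real.log n ^ m * (n : ℝ) ^ β * (d n : ℝ) ^ (-γ)
        ≤ Real.log n ^ m * (n : ℝ) ^ β * ((2 : ℝ) ^ γ * (n : ℝ) ^ (-(α * γ))) := by
          rw [← h4]; gcongr
      _ = (2 : ℝ) ^ γ * (Real.log n ^ m * ((n : ℝ) ^ β * (n : ℝ) ^ (-(α * γ)))) := by ring
      _ = _ := by rw [← Real.rpow_add hn, ← sub_eq_add_neg]

theorem eventually_constraints_le {r : ℝ} (hα : 0 < α) (hr : 0 < r)
    (hd : ∀ n : ℕ, IsRounding (d n) ((n : ℝ) ^ α)) {t : ℕ → ℕ}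
    (ht : ∀ n : ℕ, IsRounding (t n) (r * (n : ℝ) * Real.log (d n : ℝ))) :
    ∀ᶠ n : ℕ in atTop, (t n : ℝ) ≤ (r * (α + 1) + 1) * n * Real.log n := by
  filter_upwards [eventually_log_domain_le hα hd,
    (tendsto_domain hα hd).eventually_ge_atTop 1,
    (Real.tendsto_log_atTop.comp tendsto_natCast_atTop_atTop).eventually_ge_atTop 1,
    eventually_ge_atTop 1] with n h1 h2 h3 h4
  simp only [Function.comp_apply] at h3
  have hn : (1 : ℝ) ≤ n := by exact_mod_cast h4
  have h5 : 0 ≤ Real.log (d n : ℝ) := Real.log_nonneg h2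
  have h6 : 1 ≤ n * Real.log n := by nlinarith
  have h7 : r * n * Real.log (d n : ℝ) ≤ r * n * ((α + 1) * Real.log n) := by gcongr
  have h8 := (ht n).le_add_one (by positivity)
  calc (t n : ℝ) ≤ r * n * ((α + 1) * Real.log n) + n * Real.log n := by linarith
    _ = _ := by ring

theorem tendsto_incompatible_ratio {k : ℕ} (hα : 0 < α) (hk : 0 < k) {p : ℝ} (hp : 0 < p)
    (hd : ∀ n : ℕ, IsRounding (d n) ((n : ℝ) ^ α)) {q : ℕ → ℕ}
    (hq : ∀ n : ℕ, IsRounding (q n) (p * (d n : ℝ) ^ k)) :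
    Tendsto (fun n => (q n : ℝ) / (d n : ℝ) ^ k) atTop (𝓝 p) := by
  have hN : Tendsto (fun n => (d n : ℝ) ^ k) atTop atTop :=
    (tendsto_pow_atTop hk.ne').comp (tendsto_domain hα hd)
  have hi := hN.inv_tendsto_atTop
  have hlo : Tendsto (fun n => p - ((d n : ℝ) ^ k)⁻¹) atTop (𝓝 p) := by
    simpa using hi.const_sub p
  have hhi : Tendsto (fun n => p + ((d n : ℝ) ^ k)⁻¹) atTop (𝓝 p) := by
    simpa using hi.const_add p
  refine tendsto_of_tendsto_of_tendsto_of_le_of_le' hlo hhi ?_ ?_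
  · filter_upwards [hN.eventually_gt_atTop 0] with n hn
    rw [le_div_iff₀ hn, sub_mul, inv_mul_cancel₀ hn.ne']
    exact (hq n).sub_one_le
  · filter_upwards [hN.eventually_gt_atTop 0] with n hn
    rw [div_le_iff₀ hn, add_mul, inv_mul_cancel₀ hn.ne']
    exact (hq n).le_add_one (by positivity)

/-- The variance of the deviation vanishes; this is where `(2 k - 1) α > 1` is needed. -/
theorem tendsto_variance {k : ℕ} (hk : 2 ≤ k) (hα : 0 < α)
    (hkα : 1 < (2 * (k : ℝ) - 1) * α) (hd : ∀ n : ℕ, IsRounding (d n) ((n : ℝ) ^ α))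
    {A : ℝ} {T : ℕ → ℝ} (hT0 : ∀ᶠ n in atTop, 0 ≤ T n)
    (hT : ∀ᶠ n : ℕ in atTop, T n ≤ A * n * Real.log n) :
    Tendsto (fun n : ℕ => T n ^ 2 * ((1 + (d n : ℝ) * k / n) ^ k - 1) / (d n : ℝ) ^ (2 * k))
      atTop (𝓝 0) := by
  have hk2 : (2 : ℝ) ≤ k := by exact_mod_cast hk
  have g1 := tendsto_log_pow_mul_rpow_mul_domain hα hd 2 (β := 1) (γ := 2 * k - 1)
    (by linarith) (by linarith)
  have g2 := tendsto_log_pow_mul_rpow_mul_domain hα hd 2 (β := 0) (γ := 1) (by norm_num)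
    (by linarith)
  have g := ((g1.const_mul (k : ℝ)).add (g2.const_mul ((k : ℝ) ^ k))).const_mul
    (A ^ 2 * (k * 2 ^ k))
  simp only [mul_zero, add_zero] at g
  refine squeeze_zero' ?_ ?_ g
  · refine Eventually.of_forall fun n => ?_
    have : 1 ≤ (1 + (d n : ℝ) * k / n) ^ k := one_le_pow₀ (by
      have : 0 ≤ (d n : ℝ) * k / n := by positivity
      linarith)
    have : 0 ≤ (1 + (d n : ℝ) * k / n) ^ k - 1 := by linarith
    positivity
  · filter_upwards [hT0, hT, (tendsto_domain hα hd).eventually_ge_atTop 1,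
      eventually_ge_atTop 1] with n h1 h2 h3 h4
    have hn : (1 : ℝ) ≤ n := by exact_mod_cast h4
    have hn0 : (0 : ℝ) < n := by linarith
    have hd0 : (0 : ℝ) < d n := by linarith
    set x : ℝ := (d n : ℝ) * k / n with hx
    have hx0 : 0 ≤ x := by positivity
    have e1 : (1 + x) ^ k - 1 ≤ k * 2 ^ k * (x + x ^ k) := by
      have a1 : (1 + x) ^ k - 1 ≤ k * (1 + x) ^ (k - 1) * x := by
        have := geom_sum_mul (1 + x) k
        rw [add_sub_cancel_left] at this
        rw [← this]
        refine mul_le_mul_of_nonneg_right ?_ hx0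
        calc _ ≤ ∑ i ∈ Finset.range k, (1 + x) ^ (k - 1) := by
              refine Finset.sum_le_sum fun i hi => pow_le_pow_right₀ (by linarith) ?_
              have := Finset.mem_range.1 hi
              omega
          _ = _ := by simp
      have a2 : (1 + x) ^ (k - 1) ≤ 2 ^ k * (1 + x ^ (k - 1)) := by
        have := add_pow_le (zero_le_one (α := ℝ)) hx0 (k - 1)
        rw [one_pow] at this
        refine this.trans ?_
        gcongr
        · norm_num
        · omega
      calc (1 + x) ^ k - 1 ≤ k * (1 + x) ^ (k - 1) * x := a1
        _ ≤ k * (2 ^ k * (1 + x ^ (k - 1))) * x := by gcongr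
        _ = k * 2 ^ k * (x + x ^ (k - 1) * x) := by ring
        _ = _ := by rw [← pow_succ, Nat.sub_add_cancel (by omega : 1 ≤ k)]
    have e2 : T n ^ 2 ≤ (A * n * Real.log n) ^ 2 := by gcongr
    have e3 : (d n : ℝ) ^ (-(2 * (k : ℝ) - 1)) = d n / (d n : ℝ) ^ (2 * k) := by
      rw [neg_sub, Real.rpow_sub hd0, Real.rpow_one]
      congr 1
      exact_mod_cast Real.rpow_natCast (d n : ℝ) (2 * k)
    have e4 : (n : ℝ) ^ 2 * x ^ k / (d n : ℝ) ^ (2 * k) ≤ (k : ℝ) ^ k * (d n : ℝ) ^ (-1 : ℝ) := by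
      have b1 : (n : ℝ) ^ 2 * x ^ k / (d n : ℝ) ^ (2 * k)
          = (k : ℝ) ^ k * ((n : ℝ) ^ 2 / (n : ℝ) ^ k * (1 / (d n : ℝ) ^ k)) := by
        rw [hx, div_pow, mul_pow, pow_mul' (d n : ℝ) 2 k]
        field_simp
      rw [b1, Real.rpow_neg_one, ← one_div]
      have b2 : (n : ℝ) ^ 2 / (n : ℝ) ^ k ≤ 1 :=
        (div_le_one (by positivity)).2 (pow_le_pow_right₀ hn hk)
      have b3 : 1 / (d n : ℝ) ^ k ≤ 1 / d n :=
        one_div_le_one_div_of_le hd0 (le_self_pow₀ h3 (by omega))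
      refine mul_le_mul_of_nonneg_left ?_ (by positivity)
      calc _ ≤ 1 * (1 / (d n : ℝ)) := by gcongr
        _ = _ := one_mul _
    rw [e3, Real.rpow_one, Real.rpow_zero, mul_one]
    calc T n ^ 2 * ((1 + x) ^ k - 1) / (d n : ℝ) ^ (2 * k)
        ≤ (A * n * Real.log n) ^ 2 * (k * 2 ^ k * (x + x ^ k)) / (d n : ℝ) ^ (2 * k) := by
          have : 0 ≤ (1 + x) ^ k - 1 := by
            have := one_le_pow₀ (n := k) (by linarith : 1 ≤ 1 + x)
            linarith
          gcongr
      _ = A ^ 2 * (k * 2 ^ k) * ((n : ℝ) ^ 2 * x * Real.log n ^ 2 / (d n : ℝ) ^ (2 * k)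
          + Real.log n ^ 2 * ((n : ℝ) ^ 2 * x ^ k / (d n : ℝ) ^ (2 * k))) := by ring
      _ ≤ A ^ 2 * (k * 2 ^ k) * ((n : ℝ) ^ 2 * x * Real.log n ^ 2 / (d n : ℝ) ^ (2 * k)
          + Real.log n ^ 2 * ((k : ℝ) ^ k * (d n : ℝ) ^ (-1 : ℝ))) := by gcongr
      _ = _ := by
          rw [hx]
          field_simp

/-- In the window around the mean agreement the rate function dominates; this too rests on
`(2 k - 1) α > 1`. -/
theorem eventually_near {k : ℕ} (hk : 2 ≤ k) (hα : 0 < α)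
    (hkα : 1 < (2 * (k : ℝ) - 1) * α) (hd : ∀ n : ℕ, IsRounding (d n) ((n : ℝ) ^ α))
    {A : ℝ} {T : ℕ → ℝ} (hT0 : ∀ᶠ n in atTop, 0 ≤ T n)
    (hT : ∀ᶠ n : ℕ in atTop, T n ≤ A * n * Real.log n) :
    ∀ᶠ n : ℕ in atTop,
      18 * (T n / (d n : ℝ) ^ k * (k * 8 ^ k)) ^ 2 * (4 * Real.log n) ≤ n / d n := by
  have hk2 : (2 : ℝ) ≤ k := by exact_mod_cast hk
  have g := (tendsto_log_pow_mul_rpow_mul_domain hα hd 3 (β := 1) (γ := 2 * k - 1)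
    (by linarith) (by linarith)).const_mul (72 * A ^ 2 * (k * 8 ^ k) ^ 2)
  rw [mul_zero] at g
  filter_upwards [hT0, hT, (tendsto_domain hα hd).eventually_ge_atTop 1,
    eventually_ge_atTop 1, g.eventually_le_const zero_lt_one] with n h1 h2 h3 h4 h5
  have hn : (1 : ℝ) ≤ n := by exact_mod_cast h4
  have hn0 : (0 : ℝ) < n := by linarith
  have hd0 : (0 : ℝ) < d n := by linarith
  have hl : 0 ≤ Real.log (n : ℝ) := Real.log_natCast_nonneg n
  have e3 : (d n : ℝ) ^ (-(2 * (k : ℝ) - 1)) = d n / (d n : ℝ) ^ (2 * k) := by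
    rw [neg_sub, Real.rpow_sub hd0, Real.rpow_one]
    congr 1
    exact_mod_cast Real.rpow_natCast (d n : ℝ) (2 * k)
  rw [e3, Real.rpow_one] at h5
  calc 18 * (T n / (d n : ℝ) ^ k * (k * 8 ^ k)) ^ 2 * (4 * Real.log n)
      ≤ 18 * (A * n * Real.log n / (d n : ℝ) ^ k * (k * 8 ^ k)) ^ 2 * (4 * Real.log n) := by
        gcongr
    _ = 72 * A ^ 2 * (k * 8 ^ k) ^ 2 * (Real.log n ^ 3 * n * (d n / (d n : ℝ) ^ (2 * k)))
        * (n / d n) := by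
        rw [pow_mul' (d n : ℝ) 2 k]
        field_simp
        ring
    _ ≤ 1 * (n / d n) := by gcongr
    _ = _ := one_mul _

theorem eventually_mid (hα : 0 < α) (hd : ∀ n : ℕ, IsRounding (d n) ((n : ℝ) ^ α))
    {δ A : ℝ} (hδ : 0 < δ) {T : ℕ → ℝ}
    (hT : ∀ᶠ n : ℕ in atTop, T n ≤ A * n * Real.log n) :
    ∀ᶠ n : ℕ in atTop, T n * (d n : ℝ) ^ (-δ) ≤ n / 2 := by
  have g := (tendsto_log_pow_mul_rpow_mul_domain hα hd 1 (β := 0) (γ := δ) hδ.le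
    (by positivity)).const_mul A
  rw [mul_zero] at g
  filter_upwards [hT, g.eventually_le_const (by norm_num : (0 : ℝ) < 1 / 2)] with n h2 h5
  rw [Real.rpow_zero, mul_one, pow_one] at h5
  calc T n * (d n : ℝ) ^ (-δ) ≤ A * n * Real.log n * (d n : ℝ) ^ (-δ) := by gcongr
    _ = n * (A * (Real.log n * (d n : ℝ) ^ (-δ))) := by ring
    _ ≤ n * (1 / 2) := by gcongr
    _ = _ := by ring

theorem eventually_size {A C₀ : ℝ} (hA : 0 ≤ A) (hC₀ : 0 ≤ C₀) {T : ℕ → ℝ}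
    (hT : ∀ᶠ n : ℕ in atTop, T n ≤ A * n * Real.log n) :
    ∀ᶠ n : ℕ in atTop, T n * (2 * (4 * Real.log n) + C₀) ^ 2 ≤ (n : ℝ) ^ 2 := by
  have g := (tendsto_log_pow_mul_rpow 3 (β := -1) (by norm_num)).const_mul (A * (8 + C₀) ^ 2)
  rw [mul_zero] at g
  filter_upwards [hT, g.eventually_le_const zero_lt_one, eventually_ge_atTop 1,
    (Real.tendsto_log_atTop.comp tendsto_natCast_atTop_atTop).eventually_ge_atTop 1]
    with n h2 h5 h4 h3
  simp only [Function.comp_apply] at h3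
  have hn : (1 : ℝ) ≤ n := by exact_mod_cast h4
  have hn0 : (0 : ℝ) < n := by linarith
  have h6 : 2 * (4 * Real.log n) + C₀ ≤ (8 + C₀) * Real.log n := by nlinarith
  rw [Real.rpow_neg_one] at h5
  calc T n * (2 * (4 * Real.log n) + C₀) ^ 2
      ≤ A * n * Real.log n * ((8 + C₀) * Real.log n) ^ 2 := by gcongr
    _ = (n : ℝ) ^ 2 * (A * (8 + C₀) ^ 2 * (Real.log n ^ 3 * (n : ℝ)⁻¹)) := by
        field_simp
    _ ≤ (n : ℝ) ^ 2 * 1 := by gcongr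
    _ = _ := mul_one _

/-! ### The two sides of the threshold -/

/-- Above the threshold the expected number of solutions tends to zero. -/
theorem tendsto_satProb_zero {k : ℕ} (hk : 2 ≤ k) {α r p : ℝ} (hα : 0 < α) (hr : 0 < r)
    (hp0 : 0 < p) (hp1 : p < 1) {d t q : ℕ → ℕ}
    (hd : ∀ n : ℕ, IsRounding (d n) ((n : ℝ) ^ α))
    (ht : ∀ n : ℕ, IsRounding (t n) (r * (n : ℝ) * Real.log (d n : ℝ)))
    (hq : ∀ n : ℕ, IsRounding (q n) (p * (d n : ℝ) ^ k))
    (hp : 1 < r * -Real.log (1 - p)) :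
    Tendsto (fun n : ℕ => satProb n (d n) k (q n) (t n)) atTop (𝓝 0) := by
  have hq' := tendsto_incompatible_ratio hα (by omega : 0 < k) hp0 hd hq
  have hlog : Tendsto (fun n => -Real.log (1 - (q n : ℝ) / (d n : ℝ) ^ k)) atTop
      (𝓝 (-Real.log (1 - p))) := by
    refine Tendsto.neg ((Real.continuousAt_log (by linarith)).tendsto.comp ?_)
    exact hq'.const_sub 1
  have hp' : 1 / r < -Real.log (1 - p) := by rwa [div_lt_iff₀' hr]
  obtain ⟨L, hL1, hL2⟩ := exists_between hp'
  have hL0 : 0 < L := (by positivity : 0 < 1 / r).trans hL1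
  have hrL : 0 < L * r - 1 := by
    have := (div_lt_iff₀ hr).1 hL1
    linarith
  have hlim : Tendsto (fun n : ℕ => Real.exp (-((L * r - 1) * (n * Real.log (d n : ℝ)) - L)))
      atTop (𝓝 0) := by
    refine Real.tendsto_exp_neg_atTop_nhds_zero.comp ?_
    refine tendsto_atTop_add_const_right _ (-L) ?_
    exact (tendsto_natCast_atTop_atTop.atTop_mul_atTop₀ (tendsto_log_domain hα hd)).const_mul_atTop
      hrL
  refine squeeze_zero' (Eventually.of_forall fun n => satProb_nonneg) ?_ hlim
  filter_upwards [hlog.eventually_const_le hL2, hq'.eventually_lt_const hp1,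
    (tendsto_domain hα hd).eventually_ge_atTop 1, eventually_ge_atTop k] with n h1 h2 h3 h4
  have hd0 : (0 : ℝ) < d n := by linarith
  have hN0 : (0 : ℝ) < (d n : ℝ) ^ k := by positivity
  have hqN : q n < d n ^ k := by
    rw [div_lt_one hN0] at h2
    exact_mod_cast h2
  have hc : (0 : ℝ) < n.choose k := by exact_mod_cast Nat.choose_pos h4
  have hC : (0 : ℝ) < (d n ^ k).choose (q n) := by exact_mod_cast Nat.choose_pos hqN.le
  have e1 := choose_pred_mul (d n ^ k) (q n) (by omega) hqN.le
  push_cast at e1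
  have e2 := eq_div_of_mul_eq hN0.ne' e1
  have h5 : 0 < 1 - (q n : ℝ) / (d n : ℝ) ^ k := by linarith
  calc satProb n (d n) k (q n) (t n)
      ≤ _ := satProb_le_first_moment
    _ = (d n : ℝ) ^ n * (1 - (q n : ℝ) / (d n : ℝ) ^ k) ^ t n := by
        rw [mul_div_assoc, ← div_pow, e2]
        congr 2
        field_simp
    _ = Real.exp (n * Real.log (d n)
          - t n * -Real.log (1 - (q n : ℝ) / (d n : ℝ) ^ k)) := by
        rw [mul_neg, sub_neg_eq_add, Real.exp_add, Real.exp_nat_mul, Real.exp_nat_mul,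
          Real.exp_log hd0, Real.exp_log h5]
    _ ≤ _ := by
        refine Real.exp_le_exp.2 ?_
        have h6 := mul_le_mul_of_nonneg_left h1 (Nat.cast_nonneg (α := ℝ) (t n))
        have h7 := mul_le_mul_of_nonneg_right (ht n).sub_one_le hL0.le
        linarith

/-- The second moment bound for a single `n`. The hypotheses `hnear`, `hmid`, `hsize` and `hfar` are
the conditions of `exp_rate_mul_weight_le` on large agreement sets, with `T = t * c`. -/
theorem one_le_satProb_mul_of_bounds {n d k q t : ℕ} (hd : 0 < d) (hk : 2 ≤ k) (hkn : k ≤ n)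
    (hN : 2 ≤ d ^ k) (hq : q < d ^ k) {c r L y δ Λ : ℝ}
    (hc : c = (q : ℝ) * (d : ℝ) ^ k / (((d : ℝ) ^ k - q) * ((d : ℝ) ^ k - 1)))
    (hL : 0 < L) (hκ : L ≤ k * (1 - Real.exp (-L))) (hy0 : 0 ≤ y) (hyL : y ≤ L)
    (hcy : c ≤ Real.exp y - 1) (ht : (t : ℝ) ≤ r * n * Real.log d + 1) (hΛ : 1 ≤ Λ)
    (hnear : 18 * (t * c / (d : ℝ) ^ k * (k * 8 ^ k)) ^ 2 * Λ ≤ n / d)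
    (hmid : t * c * (d : ℝ) ^ (-δ) ≤ n / 2)
    (hsize : t * c * (2 * Λ + y) ^ 2 ≤ (n : ℝ) ^ 2)
    (hfar : 2 ≤ (1 - δ - r * y) * Real.log d) :
    1 ≤ satProb n d k q t *
      (1 + ((t * c) ^ 2 * ((1 + (d : ℝ) * k / n) ^ k - 1) / (d : ℝ) ^ (2 * k)
        + (n + 1) * Real.exp (-Λ))) := by
  have hN2 : (2 : ℝ) ≤ (d : ℝ) ^ k := by exact_mod_cast hN
  have hqN : (q : ℝ) + 1 ≤ (d : ℝ) ^ k := by exact_mod_cast hq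
  have hn0 : (0 : ℝ) < n := by
    have : 0 < n := by omega
    exact_mod_cast this
  have hc0 : 0 ≤ c := by
    rw [hc]
    have : (0 : ℝ) < (d : ℝ) ^ k - q := by linarith
    have : (0 : ℝ) < (d : ℝ) ^ k - 1 := by linarith
    positivity
  have hcN : c * (1 / (d : ℝ) ^ k) ≤ 1 := by
    have h1 : (1 : ℝ) ≤ (d : ℝ) ^ k - q := by linarith
    have h2 : (0 : ℝ) < (d : ℝ) ^ k - 1 := by linarith
    have h3 : c * (1 / (d : ℝ) ^ k) = q / (((d : ℝ) ^ k - q) * ((d : ℝ) ^ k - 1)) := by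
      rw [hc]; field_simp
    rw [h3]
    refine div_le_one_of_le₀ ?_ (by positivity)
    calc (q : ℝ) ≤ 1 * ((d : ℝ) ^ k - 1) := by linarith
      _ ≤ _ := by gcongr
  have hbase : ∀ j : ℕ,
      0 ≤ 1 + c * ((j.choose k : ℝ) / (n.choose k : ℝ) - 1 / (d : ℝ) ^ k) := by
    intro j
    have : 0 ≤ c * ((j.choose k : ℝ) / (n.choose k : ℝ)) := by positivity
    rw [mul_sub]
    linarith
  have hexp : ∀ j : ℕ,
      (1 + c * ((j.choose k : ℝ) / (n.choose k : ℝ) - 1 / (d : ℝ) ^ k)) ^ t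
        ≤ Real.exp (overlapDev n d k (t * c) j) := by
    intro j
    rw [overlapDev, mul_assoc, Real.exp_nat_mul]
    refine pow_le_pow_left₀ (hbase j) ?_ t
    rw [add_comm]
    exact Real.add_one_le_exp _
  have hexp' : ∀ j : ℕ, 0 < j → j ≤ n →
      (1 + c * ((j.choose k : ℝ) / (n.choose k : ℝ) - 1 / (d : ℝ) ^ k)) ^ t
        ≤ Real.exp (r * y * j * Real.log d + y) := by
    intro j hj0 hjn
    have hj0' : (0 : ℝ) < j := by exact_mod_cast hj0
    have hjn' : (j : ℝ) / n ≤ 1 := (div_le_one hn0).2 (by exact_mod_cast hjn)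
    have h1 := one_add_mul_pow_le_exp hL hκ hy0 hyL (by positivity : 0 < (j : ℝ) / n) hjn'
    have h2 : 1 + c * ((j.choose k : ℝ) / (n.choose k : ℝ) - 1 / (d : ℝ) ^ k)
        ≤ 1 + (Real.exp y - 1) * ((j : ℝ) / n) ^ k := by
      have h3 := choose_div_choose_le hkn hjn
      have h4 : (0 : ℝ) ≤ 1 / (d : ℝ) ^ k := by positivity
      have h5 : (0 : ℝ) ≤ ((j : ℝ) / n) ^ k := by positivity
      have h6 : c * ((j.choose k : ℝ) / (n.choose k : ℝ) - 1 / (d : ℝ) ^ k)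
          ≤ c * ((j : ℝ) / n) ^ k := mul_le_mul_of_nonneg_left (by linarith) hc0
      have h7 := mul_le_mul_of_nonneg_right hcy h5
      linarith
    refine (pow_le_pow_left₀ (hbase j) (h2.trans h1) t).trans ?_
    rw [← Real.exp_nat_mul]
    refine Real.exp_le_exp.2 ?_
    calc (t : ℝ) * (y * (j / n)) ≤ (r * n * Real.log d + 1) * (y * (j / n)) := by gcongr
      _ = r * y * j * Real.log d + y * (j / n) := by field_simp
      _ ≤ r * y * j * Real.log d + y * 1 := by gcongr
      _ = _ := by rw [mul_one]
  refine one_le_satProb_mul hd hkn hN hq hc fun σ => ?_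
  rw [← add_assoc]
  refine sum_weight_agreeSet_le σ hd (by omega) hkn (by positivity : (0 : ℝ) ≤ t * c)
    (fun j => (1 + c * ((j.choose k : ℝ) / (n.choose k : ℝ) - 1 / (d : ℝ) ^ k)) ^ t)
    (fun j _ => pow_nonneg (hbase j) t) (fun j _ => hexp j) ?_ (Real.exp_pos _).le
  intro j hjn hj0 hZ
  exact exp_rate_mul_weight_le hd hk hkn hj0 hjn (by positivity) hΛ hy0 hZ (hexp j)
    (hexp' j hj0 hjn) hnear hmid hsize hfar

/-- Below the threshold the second moment is asymptotic to the square of the first. -/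
theorem tendsto_satProb_one {k : ℕ} (hk : 2 ≤ k) {α r p : ℝ} (hα : 0 < α) (hr : 0 < r)
    (hkα : 1 < (2 * (k : ℝ) - 1) * α)
    (hκ : 1 / r ≤ k * (1 - Real.exp (-(1 / r))))
    (hp0 : 0 < p) (hp1 : p < 1) {d t q : ℕ → ℕ}
    (hd : ∀ n : ℕ, IsRounding (d n) ((n : ℝ) ^ α))
    (ht : ∀ n : ℕ, IsRounding (t n) (r * (n : ℝ) * Real.log (d n : ℝ)))
    (hq : ∀ n : ℕ, IsRounding (q n) (p * (d n : ℝ) ^ k))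
    (hp : r * -Real.log (1 - p) < 1) :
    Tendsto (fun n : ℕ => satProb n (d n) k (q n) (t n)) atTop (𝓝 1) := by
  have hq' := tendsto_incompatible_ratio hα (by omega : 0 < k) hp0 hd hq
  have hN : Tendsto (fun n => (d n : ℝ) ^ k) atTop atTop :=
    (tendsto_pow_atTop (by omega)).comp (tendsto_domain hα hd)
  have hp' : -Real.log (1 - p) < 1 / r := by rwa [lt_div_iff₀' hr]
  -- The slack between `y` and `-log (1 - p)` absorbs the rounding of `q`, the slack between `y`
  -- and `1 / r` gives the exponential gain for large agreement sets.
  obtain ⟨y, hy1, hy2⟩ := exists_between hp'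
  have hy0 : 0 < y := by
    have := Real.log_neg (by linarith : 0 < 1 - p) (by linarith)
    linarith
  have hry : r * y < 1 := by
    rwa [lt_div_iff₀' hr] at hy2
  set δ : ℝ := (1 - r * y) / 2 with hδ
  have hδ0 : 0 < δ := by rw [hδ]; linarith
  set c : ℕ → ℝ := fun n =>
    (q n : ℝ) * (d n : ℝ) ^ k / (((d n : ℝ) ^ k - q n) * ((d n : ℝ) ^ k - 1)) with hcdef
  have hclim : Tendsto c atTop (𝓝 (p / ((1 - p) * 1))) := by
    have h1 : Tendsto (fun n => 1 - ((d n : ℝ) ^ k)⁻¹) atTop (𝓝 1) := by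
      simpa using hN.inv_tendsto_atTop.const_sub 1
    have h2 := hq'.div ((hq'.const_sub 1).mul h1) (by
      rw [mul_one]; linarith)
    refine h2.congr' ?_
    filter_upwards [hN.eventually_gt_atTop 0] with n hn
    simp only [hcdef, Pi.div_apply]
    have e1 : (1 - (q n : ℝ) / (d n : ℝ) ^ k) * (1 - ((d n : ℝ) ^ k)⁻¹)
        = (((d n : ℝ) ^ k - q n) * ((d n : ℝ) ^ k - 1)) / ((d n : ℝ) ^ k * (d n : ℝ) ^ k) := by
      field_simp
    rw [e1, div_div_div_eq, ← mul_assoc, mul_div_mul_comm, mul_div_cancel_right₀ _ hn.ne',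
      mul_div_assoc]
  have hcy : p / ((1 - p) * 1) < Real.exp y - 1 := by
    have h1 := Real.exp_lt_exp.2 hy1
    rw [Real.exp_neg, Real.exp_log (by linarith)] at h1
    have h2 : p / ((1 - p) * 1) = (1 - p)⁻¹ - 1 := by
      have : 1 - p ≠ 0 := by linarith
      field_simp
      ring
    linarith
  have hK : 0 < Real.exp y - 1 := by linarith [Real.add_one_lt_exp hy0.ne']
  have hqlt : ∀ᶠ n in atTop, q n < d n ^ k := by
    filter_upwards [hq'.eventually_lt_const hp1, hN.eventually_gt_atTop 0] with n h1 h2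
    rw [div_lt_one h2] at h1
    exact_mod_cast h1
  have hT0 : ∀ᶠ n in atTop, 0 ≤ (t n : ℝ) * c n := by
    filter_upwards [hqlt, hN.eventually_ge_atTop 1] with n h1 h2
    have h3 : (q n : ℝ) < (d n : ℝ) ^ k := by exact_mod_cast h1
    have h4 : 0 ≤ (d n : ℝ) ^ k - q n := by linarith
    have h5 : 0 ≤ (d n : ℝ) ^ k - 1 := by linarith
    simp only [hcdef]
    positivity
  set A : ℝ := (Real.exp y - 1) * (r * (α + 1) + 1) with hA
  have hA0 : 0 ≤ A := by positivity
  have hT : ∀ᶠ n : ℕ in atTop, (t n : ℝ) * c n ≤ A * n * Real.log n := by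
    filter_upwards [eventually_constraints_le hα hr hd ht, hclim.eventually_le_const hcy]
      with n h1 h2
    calc (t n : ℝ) * c n ≤ t n * (Real.exp y - 1) := by gcongr
      _ ≤ (r * (α + 1) + 1) * n * Real.log n * (Real.exp y - 1) := by gcongr
      _ = _ := by rw [hA]; ring
  have hvar := tendsto_variance hk hα hkα hd hT0 hT
  have htail : Tendsto (fun n : ℕ => ((n : ℝ) + 1) * Real.exp (-(4 * Real.log n)))
      atTop (𝓝 0) := by
    have h1 : Tendsto (fun n : ℕ => 2 * (n : ℝ)⁻¹) atTop (𝓝 0) := by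
      simpa using (tendsto_inv_atTop_nhds_zero_nat (𝕜 := ℝ)).const_mul 2
    refine squeeze_zero' (Eventually.of_forall fun n => by positivity) ?_ h1
    filter_upwards [eventually_ge_atTop 1] with n hn
    have hn1 : (1 : ℝ) ≤ n := by exact_mod_cast hn
    have h2 : Real.exp (-(4 * Real.log n)) ≤ ((n : ℝ)⁻¹) * (n : ℝ)⁻¹ := by
      rw [← mul_inv, ← Real.exp_log (by positivity : (0 : ℝ) < n * n), ← Real.exp_neg,
        Real.log_mul (by positivity) (by positivity)]
      refine Real.exp_le_exp.2 ?_
      linarith [Real.log_nonneg hn1]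
    calc ((n : ℝ) + 1) * Real.exp (-(4 * Real.log n))
        ≤ (2 * n) * (((n : ℝ)⁻¹) * (n : ℝ)⁻¹) := by gcongr; linarith
      _ = _ := by field_simp
  have hη := (hvar.add htail).const_add 1
  simp only [add_zero] at hη
  have hinv := hη.inv₀ one_ne_zero
  rw [inv_one] at hinv
  refine tendsto_of_tendsto_of_tendsto_of_le_of_le' hinv tendsto_const_nhds ?_
    (Eventually.of_forall fun n => satProb_le_one)
  filter_upwards [eventually_near hk hα hkα hd hT0 hT, eventually_mid hα hd hδ0 hT,
    eventually_size hA0 hy0.le hT, hclim.eventually_le_const hcy, hqlt,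
    hN.eventually_ge_atTop 2, (tendsto_domain hα hd).eventually_ge_atTop 1,
    eventually_ge_atTop k,
    (Real.tendsto_log_atTop.comp tendsto_natCast_atTop_atTop).eventually_ge_atTop 1,
    ((tendsto_log_domain hα hd).const_mul_atTop hδ0).eventually_ge_atTop 2, hT0]
    with n h1 h2 h3 h4 h5 h6 h7 h8 h9 h10 h11
  simp only [Function.comp_apply] at h9
  have hd0 : 0 < d n := by
    have : (1 : ℕ) ≤ d n := by exact_mod_cast h7
    omega
  have htn : (t n : ℝ) ≤ r * n * Real.log (d n) + 1 :=
    (ht n).le_add_one (mul_nonneg (by positivity) (Real.log_nonneg h7))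
  have hfar : 2 ≤ (1 - δ - r * y) * Real.log (d n : ℝ) := by
    have : 1 - δ - r * y = δ := by rw [hδ]; ring
    rwa [this]
  have key := one_le_satProb_mul_of_bounds hd0 hk h8 (by exact_mod_cast h6) h5 rfl
    (by positivity : 0 < 1 / r) hκ hy0.le hy2.le h4 htn (by linarith : 1 ≤ 4 * Real.log n)
    h1 h2 h3 hfar
  have hpos : 0 ≤ ((t n : ℝ) * c n) ^ 2 * ((1 + (d n : ℝ) * k / n) ^ k - 1) / (d n : ℝ) ^ (2 * k)
      := by
    have : 1 ≤ (1 + (d n : ℝ) * k / n) ^ k := one_le_pow₀ (by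
      have : 0 ≤ (d n : ℝ) * k / n := by positivity
      linarith)
    have : 0 ≤ (1 + (d n : ℝ) * k / n) ^ k - 1 := by linarith
    positivity
  rw [inv_le_iff_one_le_mul₀ (by positivity)]
  exact key

end ModelRB

/-- Sharp threshold of Model RB with `p` as the control parameter. For each number `n` of variables,
`d n`, `t n` and `q n` are the domain size `n ^ α`, the number `r n ln d` of constraints and the
number `p d ^ k` of incompatible tuples per constraint, rounded in any way to integers. -/
theorem theorem3p2 (k : ℕ) (hk : 2 ≤ k) (α r τ p_cr : ℝ) (hα : 0 < α) (hr : 0 < r)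
    (hτ : τ = Real.exp (1 / r)) (hp_cr : p_cr = 1 - 1 / τ)
    (hkα : 1 < (2 * (k : ℝ) - 1) * α)
    (hkτ : τ * Real.log τ / (τ - 1) ≤ (k : ℝ))
    (p : ℝ) (hp0 : 0 < p) (hp1 : p < 1)
    (d t q : ℕ → ℕ)
    (hd : ∀ n : ℕ, ModelRB.IsRounding (d n) ((n : ℝ) ^ α))
    (ht : ∀ n : ℕ, ModelRB.IsRounding (t n) (r * (n : ℝ) * Real.log (d n : ℝ)))
    (hq : ∀ n : ℕ, ModelRB.IsRounding (q n) (p * (d n : ℝ) ^ k)) :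
    (p < p_cr → Tendsto (fun n : ℕ => ModelRB.satProb n (d n) k (q n) (t n)) atTop (𝓝 1)) ∧
    (p_cr < p → Tendsto (fun n : ℕ => ModelRB.satProb n (d n) k (q n) (t n)) atTop (𝓝 0)) := by
  have hτ' : 1 / τ = Real.exp (-(1 / r)) := by rw [hτ, Real.exp_neg, one_div]
  have h1p : 0 < 1 - p := by linarith
  have hr1 : r * (1 / r) = 1 := by field_simp
  refine ⟨fun h => ?_, fun h => ?_⟩
  · refine ModelRB.tendsto_satProb_one hk hα hr hkα ?_ hp0 hp1 hd ht hq ?_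
    · have hτ1 : 0 < τ - 1 := by
        have := Real.add_one_lt_exp (one_div_pos.2 hr).ne'
        have := one_div_pos.2 hr
        linarith
      have hτ0 : 0 < τ := by linarith
      rw [div_le_iff₀ hτ1, hτ, Real.log_exp, ← hτ] at hkτ
      rw [← hτ']
      refine le_of_mul_le_mul_left (hkτ.trans (le_of_eq ?_)) hτ0
      field_simp
    · have h2 : Real.exp (-(1 / r)) < 1 - p := by linarith
      have h3 := (Real.lt_log_iff_exp_lt h1p).2 h2
      have h4 := mul_lt_mul_of_pos_left h3 hr
      linarith
  · refine ModelRB.tendsto_satProb_zero hk hα hr hp0 hp1 hd ht hq ?_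
    have h2 : 1 - p < Real.exp (-(1 / r)) := by linarith
    have h3 := (Real.log_lt_iff_lt_exp h1p).2 h2
    have h4 := mul_lt_mul_of_pos_left h3 hr
    linarith
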